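/- **Setting.** Let $n\ge 2$, $l\ge 1$. All derivatives below are real derivatives on $\mathbb C^n=\mathbb R^{2n}$; $|\cdot|_2$ is the Hermitian norm, $\mathrm{mes}_{2n}$ is Lebesgue measure, and distances and diameters are taken for $|\cdot|_2$. For a $C^p$ map $f$ with values in $\mathbb R$ or $\mathbb C^l$ put $$\|D^kf(y)\|=\sup_{|a|_2=1}|D^kf(y)(a,\dots,a)|_2,\quad \|f(y)\|_p=\max_{0\le k\le p}\|D^kf(y)\|,\quad \|f\|_{\mathcal B,p}=\sup_{y\in\mathcal B}\|f(y)\|_p .$$ For $c\in\mathbb C^l$ put $(c,f)=\sum_j c_jf_j$, and let $\mathbb S^l=\{c\in\mathbb C^l : |c|_2=1\}$. *Nondegeneracy.* Let $\mathcal U\subset\mathbb C^n$ be a connected open neighbourhood of $0$. A holomorphic map $f:\mathcal U\to\mathbb C^l$ is nondegenerate if, for every $c\ne 0$, $(c,f)$ does not vanish identically on $\mathcal U$. For a nonempty compact set $\mathcal K\subset\mathcal U$ put $\beta(\mu)=\min_{y\in\mathcal K,\,c\in\mathbb S^l}\big\|\,|(c,f)|^2(y)\big\|_\mu$. The index of nondegeneracy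 $\mu_0$ of $f$ with respect to $\mathcal K$ is the smallest positive integer $\mu$ with $\beta(\mu)>0$, and $\beta:=\beta(\mu_0)$. *Weights.* Let $\mathfrak g$ be a commutative complex Lie algebra with basis $g_1,\dots,g_l$ and let $S(x)=\sum_{i=1}^n\lambda_i(x)\,x_i\,\partial/\partial x_i$ ($x\in\mathfrak g$) be an injective Lie morphism from $\mathfrak g$ to the diagonal linear vector fields of $\mathbb C^n$. Let $\mathcal W^{k,m}_{n,*}$ be the set of nonzero linear forms $\sum_jq_j\lambda_j-\lambda_i$ on $\mathfrak g$ with $1\le i\le n$, $Q\in\mathbb N^n$ and $k\le|Q|=q_1+\dots+q_n\le m$. For $k\ge1$ put $$\omega_k(S)=\min\Big\{\max_j|\alpha(g_j)| : \alpha\in\mathcal W_{n,*}^{2^{k-1}+1,2^k}\Big\}.$$ *Diophantine conditions.* A diophantine sequence is a nonincreasing sequence $\omega=(\omega_k)_{k\ge1}$ in $]0,1]$ with $\sum_k -2^{-k}\ln\omega_k<\infty$. Put $a_k=(\omega_k/\omega_k(S))^{2/\mu_0}$. $S$ is strictly diophantine relatively to $(\omega,\mu_0)$ if $\omega$ is a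 diophantine sequence and $\lim_{k\to\infty}(2^k+n+1)^{n+1}a_k=0$. Put then $$M_{\omega,\omega(S),2/\mu_0}=\sup_{k\ge1}(2^k+n+1)^{n+1}a_k,\qquad M_{\omega,\omega(S)}=\sup_{k\ge1}\frac{\omega_k}{\omega_k(S)} .$$ **Proposition.** Let $f:\mathcal U\to\mathbb C^l$ be a nondegenerate holomorphic map on a connected open neighbourhood $\mathcal U$ of $0$ in $\mathbb C^n$, let $\mathcal K\subset\mathcal U$ be a nonempty compact set, let $\mu_0,\beta$ be as above, and assume that $S$ is strictly diophantine relatively to $(\omega,\mu_0)$. Let $0<\vartheta<\mathrm{dist}(\mathcal K,\mathbb C^n\setminus\mathcal U)$ (any $\vartheta>0$ if $\mathcal U=\mathbb C^n$), and let $\mathcal K_\vartheta$ be the open $\vartheta$-neighbourhood of $\mathcal K$. Let $\tilde f\in C^{\mu_0}(\mathcal K_\vartheta,\mathbb C^l)$ satisfy $$\|f-\tilde f\|_{\mathcal K_\vartheta,\mu_0}\le\frac{-\|f\|_{\mathcal K_\vartheta,\mu_0}+\sqrt{\|f\|_{\mathcal K_\vartheta,\mu_0}^2+\beta/2^{\mu_0-1}}}{2}.$$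 Let $0<\epsilon^*<\mathrm{mes}_{2n}\mathcal K$ and $0<\gamma\le\gamma^*$, where $$\gamma^*=\min\left[\left(\frac{\epsilon^*(n-1)!}{M\left((2^2+n)^na_2-(n+1)a_1+\frac n4M_{\omega,\omega(S),2/\mu_0}\right)}\right)^{\mu_0/2},\ \frac1{M_{\omega,\omega(S)}}\sqrt{\frac{\beta}{2\mu_0+2}}\right],$$ $$M=B\,d^{2n-1}\left(\frac1{\sqrt{2n}}+2d+\frac d\vartheta\right)\beta^{-\frac1{\mu_0}-1}\sup_{c\in\mathbb S^l}\big\|\,|(c,f)|^2\big\|_{\mathcal K_\vartheta,\mu_0+1},\qquad B=\frac{3(2\pi e)^n(\mu_0+1)^{\mu_0+2}}{(\mu_0+1)!},$$ and $d$ is the diameter of $\mathcal K$. Then the set $$\mathcal H(\tilde f)=\Big\{b\in\mathcal K : \forall i\ge1,\ \forall\alpha\in\mathcal W_{n,*}^{2^{i-1}+1,2^i},\ \Big|\alpha\Big(\sum_{j=1}^l\tilde f_j(b)g_j\Big)\Big|\ge\gamma\,\omega_i\Big\}$$ satisfies $\mathrm{mes}_{2n}\mathcal H(\tilde f)\ge\mathrm{mes}_{2n}\mathcal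 K-\epsilon^*$. -/

import Mathlib

open MeasureTheory Filter Topology
open scoped ENNReal

attribute [local instance 100] LieRing.ofAssociativeRing

noncomputable section

/-- `ℂ^m` with the norm `|x|₂ = (|x₁|² + ⋯ + |x_m|²)^{1/2}`. As a real vector space it is `ℝ^{2m}`,
with the same norm, and its `volume` is the `2m`-dimensional Lebesgue measure. -/
abbrev CSpace (m : ℕ) : Type := EuclideanSpace ℂ (Fin m)

/-! ### Norms of `C^p` maps (all derivatives are over the reals) -/

section CkNorms

variable {E F : Type*} [NormedAddCommGroup E] [NormedSpace ℝ E]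
  [NormedAddCommGroup F] [NormedSpace ℝ F]

/-- `‖f(y)‖_p = max_{0 ≤ k ≤ p} sup_{|a| = 1} |D^k f(y)(a, …, a)|`. -/
def ckNormAt (p : ℕ) (f : E → F) (y : E) : ℝ≥0∞ :=
  ⨆ k : ℕ, ⨆ _ : k ≤ p, ⨆ a : E, ⨆ _ : ‖a‖ = 1, ‖iteratedFDeriv ℝ k f y (fun _ => a)‖ₑ

/-- `‖f‖_{B,p} = sup_{y ∈ B} ‖f(y)‖_p`, with value `∞` if the derivatives are unbounded on `B`. -/
def ckNormOn (B : Set E) (p : ℕ) (f : E → F) : ℝ≥0∞ :=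
  ⨆ y : E, ⨆ _ : y ∈ B, ckNormAt p f y

end CkNorms

/-! ### Nondegenerate maps, index and amount of nondegeneracy -/

section Nondegeneracy

variable {n l : ℕ}

/-- `|(c, f(y))|²`, where `(c, f) = ∑ j, c_j f_j`. -/
def pairSq (c : CSpace l) (f : CSpace n → CSpace l) (y : CSpace n) : ℝ :=
  ‖∑ j, c j * f y j‖ ^ 2

/-- For every `c ≠ 0`, the function `∑ j, c_j f_j` does not vanish identically on `U`. -/
def IsNondegenerateOn (U : Set (CSpace n)) (f : CSpace n → CSpace l) : Prop :=
  ∀ c : CSpace l, c ≠ 0 → ∃ y ∈ U, ∑ j, c j * f y j ≠ 0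

/-- `β(μ, f, K) = min_{y ∈ K, |c| = 1} max_{0 ≤ k ≤ μ} ‖D^k |(c,f)|²(y)‖`. -/
def nondegBeta (μ : ℕ) (f : CSpace n → CSpace l) (K : Set (CSpace n)) : ℝ≥0∞ :=
  ⨅ y : CSpace n, ⨅ _ : y ∈ K, ⨅ c : CSpace l, ⨅ _ : ‖c‖ = 1, ckNormAt μ (pairSq c f) y

/-- The index of nondegeneracy of `f` with respect to `K`: the smallest positive integer `N` with
`β(N, f, K) > 0`. -/
def nondegIndex (f : CSpace n → CSpace l) (K : Set (CSpace n)) : ℕ :=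
  sInf {N : ℕ | 0 < N ∧ 0 < nondegBeta N f K}

/-- The amount of nondegeneracy of `f` with respect to `K`. -/
def nondegAmount (f : CSpace n → CSpace l) (K : Set (CSpace n)) : ℝ :=
  (nondegBeta (nondegIndex f K) f K).toReal

end Nondegeneracy

/-! ### Weights of a diagonal morphism

A linear vector field `∑ i j, A i j x_j ∂/∂x_i` on `ℂ^n` is given by its matrix `A`. A morphism `S`
from a commutative Lie algebra is diagonal if all the matrices `S x` are diagonal; then
`S x = ∑ i, λ_i(x) x_i ∂/∂x_i` where `λ_i(x)` is the `i`-th diagonal entry. -/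

section Weights

variable {n l : ℕ} {𝔤 : Type*} [LieRing 𝔤] [LieAlgebra ℂ 𝔤]

/-- The linear form `λ_i` on `𝔤`. -/
def eigenForm (S : 𝔤 →ₗ⁅ℂ⁆ Matrix (Fin n) (Fin n) ℂ) (i : Fin n) : Module.Dual ℂ 𝔤 where
  toFun x := S x i i
  map_add' x y := by simp
  map_smul' r x := by simp

/-- The weight `α_{Q,i} = ∑ j, q_j λ_j - λ_i`. -/
def weightForm (S : 𝔤 →ₗ⁅ℂ⁆ Matrix (Fin n) (Fin n) ℂ) (Q : Fin n → ℕ) (i : Fin n) :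
    Module.Dual ℂ 𝔤 :=
  ∑ j, Q j • eigenForm S j - eigenForm S i

/-- The set of nonzero weights `α_{Q,i}` of `S` with `k ≤ |Q| ≤ m`. -/
def nonzeroWeights (S : 𝔤 →ₗ⁅ℂ⁆ Matrix (Fin n) (Fin n) ℂ) (k m : ℕ) : Set (Module.Dual ℂ 𝔤) :=
  {α | α ≠ 0 ∧ ∃ (Q : Fin n → ℕ) (i : Fin n), k ≤ ∑ j, Q j ∧ ∑ j, Q j ≤ m ∧ α = weightForm S Q i}

/-- The norm `max_j |α(g_j)|` on the dual of `𝔤`. -/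
def dualMaxNorm (g : Module.Basis (Fin l) ℂ 𝔤) (α : Module.Dual ℂ 𝔤) : ℝ :=
  ⨆ j, ‖α (g j)‖

/-- `ω_k(S)`, for `k ≥ 1`: the smallest norm of the nonzero weights of degree in
`[2^(k-1) + 1, 2^k]`. -/
def omegaS (g : Module.Basis (Fin l) ℂ 𝔤) (S : 𝔤 →ₗ⁅ℂ⁆ Matrix (Fin n) (Fin n) ℂ) (k : ℕ) : ℝ :=
  sInf (dualMaxNorm g '' nonzeroWeights S (2 ^ (k - 1) + 1) (2 ^ k))

end Weights

/-! ### Diophantine sequences -/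

/-- A sequence `(ω_k)_{k ≥ 1}` in `]0, 1]`, nonincreasing, with `∑ -ln ω_k / 2^k < ∞`.
The value `ω 0` plays no role. -/
structure IsDiophantineSeq (ω : ℕ → ℝ) : Prop where
  pos : ∀ k, 1 ≤ k → 0 < ω k
  le_one : ∀ k, 1 ≤ k → ω k ≤ 1
  antitone : ∀ k, 1 ≤ k → ω (k + 1) ≤ ω k
  summable : Summable fun k : ℕ => -Real.log (ω (k + 1)) / 2 ^ (k + 1)

section StrictlyDiophantine

variable {n l : ℕ} {𝔤 : Type*} [LieRing 𝔤] [LieAlgebra ℂ 𝔤]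

/-- `a_k = (ω_k / ω_k(S))^{2/μ₀}`. -/
def ratioPow (g : Module.Basis (Fin l) ℂ 𝔤) (S : 𝔤 →ₗ⁅ℂ⁆ Matrix (Fin n) (Fin n) ℂ)
    (ω : ℕ → ℝ) (μ₀ k : ℕ) : ℝ :=
  (ω k / omegaS g S k) ^ (2 / (μ₀ : ℝ))

/-- `S` is strictly diophantine relatively to `(ω, μ₀)`. -/
structure IsStrictlyDiophantine (g : Module.Basis (Fin l) ℂ 𝔤)
    (S : 𝔤 →ₗ⁅ℂ⁆ Matrix (Fin n) (Fin n) ℂ) (ω : ℕ → ℝ) (μ₀ : ℕ) : Prop where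
  diophantine : IsDiophantineSeq ω
  tendsto_zero :
    Tendsto (fun k : ℕ => ((2 : ℝ) ^ k + n + 1) ^ (n + 1) * ratioPow g S ω μ₀ k) atTop (𝓝 0)

/-- `M_{ω,ω(S),2/μ₀} = sup_{k ≥ 1} (2^k + n + 1)^{n+1} (ω_k / ω_k(S))^{2/μ₀}`. -/
def supWeightedRatio (g : Module.Basis (Fin l) ℂ 𝔤) (S : 𝔤 →ₗ⁅ℂ⁆ Matrix (Fin n) (Fin n) ℂ)
    (ω : ℕ → ℝ) (μ₀ : ℕ) : ℝ :=
  ⨆ k : {k : ℕ // 1 ≤ k}, ((2 : ℝ) ^ (k : ℕ) + n + 1) ^ (n + 1) * ratioPow g S ω μ₀ k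

/-- `M_{ω,ω(S)} = sup_{k ≥ 1} ω_k / ω_k(S)`. -/
def supRatio (g : Module.Basis (Fin l) ℂ 𝔤) (S : 𝔤 →ₗ⁅ℂ⁆ Matrix (Fin n) (Fin n) ℂ)
    (ω : ℕ → ℝ) : ℝ :=
  ⨆ k : {k : ℕ // 1 ≤ k}, ω k / omegaS g S k

end StrictlyDiophantine

/-! ### The constants -/

section Constants

variable {n l : ℕ}

/-- `B = 3 (2πe)^n (μ₀+1)^{μ₀+2} / (μ₀+1)!`. -/
def constB (n μ₀ : ℕ) : ℝ :=
  3 * (2 * Real.pi * Real.exp 1) ^ n * ((μ₀ : ℝ) + 1) ^ (μ₀ + 2) / ((μ₀ + 1).factorial : ℝ)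

/-- `M = B d^{2n-1} (1/√(2n) + 2d + d/ϑ) β^{-1/μ₀-1} sup_{|c|=1} ‖|(f,c)|²‖_{K_ϑ,μ₀+1}`, where `d` is
the diameter of `K`, and `μ₀`, `β` are the index and the amount of nondegeneracy. -/
def constM (f : CSpace n → CSpace l) (K : Set (CSpace n)) (ϑ : ℝ) : ℝ :=
  constB n (nondegIndex f K) * Metric.diam K ^ (2 * n - 1) *
    (1 / √(2 * (n : ℝ)) + 2 * Metric.diam K + Metric.diam K / ϑ) *
    nondegAmount f K ^ (-1 / (nondegIndex f K : ℝ) - 1) *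
    (⨆ c : CSpace l, ⨆ _ : ‖c‖ = 1,
      ckNormOn (Metric.thickening ϑ K) (nondegIndex f K + 1) (pairSq c f)).toReal

/-- `(-‖f‖ + (‖f‖² + β / 2^{μ₀-1})^{1/2}) / 2`, where `‖f‖ = ‖f‖_{K_ϑ,μ₀}`. -/
def closenessBound (f : CSpace n → CSpace l) (K : Set (CSpace n)) (ϑ : ℝ) : ℝ :=
  (-(ckNormOn (Metric.thickening ϑ K) (nondegIndex f K) f).toReal +
    √((ckNormOn (Metric.thickening ϑ K) (nondegIndex f K) f).toReal ^ 2 +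
      nondegAmount f K / (2 : ℝ) ^ ((nondegIndex f K : ℤ) - 1))) / 2

variable {𝔤 : Type*} [LieRing 𝔤] [LieAlgebra ℂ 𝔤]

/-- The threshold `γ*`. -/
def gammaStar (g : Module.Basis (Fin l) ℂ 𝔤) (S : 𝔤 →ₗ⁅ℂ⁆ Matrix (Fin n) (Fin n) ℂ)
    (ω : ℕ → ℝ) (f : CSpace n → CSpace l) (K : Set (CSpace n)) (ϑ ε : ℝ) : ℝ :=
  min
    ((ε * ((n - 1).factorial : ℝ) /
        (constM f K ϑ *
          ((2 ^ 2 + (n : ℝ)) ^ n * ratioPow g S ω (nondegIndex f K) 2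
            - ((n : ℝ) + 1) * ratioPow g S ω (nondegIndex f K) 1
            + (n : ℝ) / 4 * supWeightedRatio g S ω (nondegIndex f K))))
      ^ ((nondegIndex f K : ℝ) / 2))
    (1 / supRatio g S ω * √(nondegAmount f K / (2 * (nondegIndex f K : ℝ) + 2)))

/-- `H(f̃)`: the set of `b ∈ K` such that `|α(∑ j, f̃_j(b) g_j)| ≥ γ ω_i` for all `i ≥ 1` and all
nonzero weights `α` of degree in `[2^(i-1) + 1, 2^i]`. -/
def diophantineSet (g : Module.Basis (Fin l) ℂ 𝔤) (S : 𝔤 →ₗ⁅ℂ⁆ Matrix (Fin n) (Fin n) ℂ)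
    (ω : ℕ → ℝ) (K : Set (CSpace n)) (γ : ℝ) (f' : CSpace n → CSpace l) : Set (CSpace n) :=
  {b ∈ K | ∀ i : ℕ, 1 ≤ i → ∀ α ∈ nonzeroWeights S (2 ^ (i - 1) + 1) (2 ^ i),
    γ * ω i ≤ ‖α (∑ j, f' b j • g j)‖}

end Constants

end

/-! The part of `K` to be discarded is the union, over k ≥ 1 and over the nonzero weights α with
degree in [2^(k-1)+1, 2^k], of the sets where |α(∑ f̃_j g_j)| < γ ω_k. Such an α evaluates to (c,
f̃) with c = (α(g_j)) and |c|₂ ≥ ω_k(S). After normalising c, everything rests on one sublevel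
estimate, `volume_norm_pairing_lt_le`: each set has measure at most M (γ ω_k/ω_k(S))^(2/μ₀). Summed
against the number of pairs (Q, i) in each dyadic block (`sum_card_degreeBlock_mul_le`), this is at
most ε* by the choice of γ*.

For the sublevel estimate, a function of one variable whose k-th derivative is at least c in
absolute value can be at most ε only on a set of length O((ε/c)^(1/k)): the interpolation error at
k+1 spaced points is controlled by Rolle (`volume_sublevel_le`). For unit c, nondegeneracy gives at
each point of `K` a direction a and an order k ≤ μ₀ for which the derivative of |(c, f)|² is almost
β. The derivative persists on a ball of radius r, by polarization of symmetric multilinear maps, so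
inside the ball the lines parallel to a meet {|(c, f̃)|² ≤ x^μ₀ β} in length at most 8(μ₀+1)x
(`exists_direction_section_le`). Fubini in each ball and averaging over the centres give the measure
bound (`volume_le_of_local_sections`).

The delicate point is the passage from f to f̃. Let F bound the derivatives of (c, f) and δ those of
the difference. The hypothesis amounts to δ(F+δ) ≤ β/2^(μ₀+1), while the Leibniz bound for the
change in |(c, f)|² is 2^k δ(2F+δ): harmless for k < μ₀, but possibly almost β for k = μ₀. In the
latter case a dichotomy helps. If the derivatives of (c, f) along a of order at most μ₀/2 are all
well below F, the Leibniz sum is smaller and something remains of β. If one of them is comparable to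
F, it survives in f̃, and the one-variable lemma is applied to a real projection of (c, f̃) itself;
squaring doubles the order, which is still at most μ₀. -/

/-! ### Sublevel sets of functions of one real variable. -/

/-- Rolle's theorem for `k + 1` zeros of a function with `k` derivatives. -/
theorem exists_zero_of_zeros {I : Set ℝ} (hI : I.OrdConnected) :
    ∀ (k : ℕ) (u : ℕ → ℝ → ℝ),
      (∀ j < k, ∀ t ∈ I, HasDerivAt (u j) (u (j + 1) t) t) →
      ∀ x : ℕ → ℝ, (∀ i < k, x i < x (i + 1)) → (∀ i ≤ k, x i ∈ I) → (∀ i ≤ k, u 0 (x i) = 0) →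
      ∃ ξ ∈ I, u k ξ = 0 := by
  intro k
  induction k with
  | zero => intro u _ x _ hxI hx; exact ⟨x 0, hxI 0 le_rfl, hx 0 le_rfl⟩
  | succ k ih =>
    intro u hu x hx hxI hx0
    have key : ∀ i ≤ k, ∃ ξ ∈ Set.Ioo (x i) (x (i + 1)), u 1 ξ = 0 := by
      intro i hi
      have hsub : Set.Icc (x i) (x (i + 1)) ⊆ I :=
        hI.out (hxI i (by omega)) (hxI (i + 1) (by omega))
      refine exists_hasDerivAt_eq_zero (f := u 0) (hx i (by omega)) ?_ ?_ ?_
      · intro t ht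
        exact (hu 0 (by omega) t (hsub ht)).continuousAt.continuousWithinAt
      · rw [hx0 i (by omega), hx0 (i + 1) (by omega)]
      · intro t ht
        exact hu 0 (by omega) t (hsub (Set.Ioo_subset_Icc_self ht))
    choose! y hy hy0 using key
    refine ih (fun j => u (j + 1)) (fun j hj t ht => hu (j + 1) (by omega) t ht) y ?_ ?_ hy0
    · intro i hi
      exact (hy i hi.le).2.trans (hy (i + 1) hi).1
    · intro i hi
      exact hI.out (hxI i (by omega)) (hxI (i + 1) (by omega))
        (Set.Ioo_subset_Icc_self (hy i hi))

/-- Nodes of spacing h are at least as far apart as h times the integers, and this product turns the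
divided difference into a sum of binomial coefficients. -/
theorem prod_erase_abs_sub (k i : ℕ) (hi : i ≤ k) :
    ∏ j ∈ (Finset.range (k + 1)).erase i, |(i : ℝ) - j| = (i.factorial : ℝ) * (k - i).factorial := by
  have hs : (Finset.range (k + 1)).erase i = Finset.range i ∪ Finset.Ico (i + 1) (k + 1) := by
    ext j; simp only [Finset.mem_erase, Finset.mem_range, Finset.mem_union, Finset.mem_Ico]; omega
  have hd : Disjoint (Finset.range i) (Finset.Ico (i + 1) (k + 1)) := by
    rw [Finset.disjoint_left]; intro j; simp only [Finset.mem_range, Finset.mem_Ico]; omega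
  rw [hs, Finset.prod_union hd]
  congr 1
  · rw [← Finset.prod_range_add_one_eq_factorial, ← Finset.prod_range_reflect]
    push_cast
    refine Finset.prod_congr rfl fun j hj => ?_
    rw [Finset.mem_range] at hj
    have : ((i - 1 - j : ℕ) : ℝ) = i - 1 - j := by
      rw [Nat.cast_sub (by omega), Nat.cast_sub (by omega)]; simp
    rw [this, abs_of_nonneg] <;> ring_nf
    have : (j : ℝ) + 1 ≤ i := by exact_mod_cast hj
    linarith
  · rw [Finset.prod_Ico_eq_prod_range, ← Finset.prod_range_add_one_eq_factorial]
    push_cast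
    refine Finset.prod_congr rfl fun j _ => ?_
    rw [abs_sub_comm, abs_of_nonneg] <;> ring_nf
    positivity

theorem mul_le_abs_sub_of_spacing {x : ℕ → ℝ} {h : ℝ} {k : ℕ}
    (hx : ∀ i < k, x i + h ≤ x (i + 1)) {i j : ℕ} (hij : i ≤ j) (hj : j ≤ k) :
    h * ((j : ℝ) - i) ≤ x j - x i := by
  induction j, hij using Nat.le_induction with
  | base => simp
  | succ j hij ih =>
    have h1 := ih (by omega)
    have h2 := hx j (by omega)
    push_cast
    linarith

/-- If `u` has `k + 1` values of absolute value at most `ε` at points with mutual distances at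
least `h`, then its `k`-th derivative is somewhere at most `2 ^ k * ε / h ^ k`. -/
theorem exists_abs_deriv_le {I : Set ℝ} (hI : I.OrdConnected) {k : ℕ} {u : ℕ → ℝ → ℝ}
    (hu : ∀ j < k, ∀ t ∈ I, HasDerivAt (u j) (u (j + 1) t) t) {ε h : ℝ} (hh : 0 < h)
    {x : ℕ → ℝ} (hx : ∀ i < k, x i + h ≤ x (i + 1)) (hxI : ∀ i ≤ k, x i ∈ I)
    (hxε : ∀ i ≤ k, |u 0 (x i)| ≤ ε) :
    ∃ ξ ∈ I, |u k ξ| * h ^ k ≤ 2 ^ k * ε := by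
  have hdist : ∀ i ≤ k, ∀ j ≤ k, h * |(i : ℝ) - j| ≤ |x i - x j| := by
    intro i hi j hj
    rcases le_total i j with hij | hij
    · have := mul_le_abs_sub_of_spacing hx hij hj
      rw [abs_sub_comm, abs_sub_comm (x i),
        abs_of_nonneg (sub_nonneg.2 (by exact_mod_cast hij : (i : ℝ) ≤ j))]
      exact this.trans (le_abs_self _)
    · have := mul_le_abs_sub_of_spacing hx hij hi
      rw [abs_of_nonneg (sub_nonneg.2 (by exact_mod_cast hij : (j : ℝ) ≤ i))]
      exact this.trans (le_abs_self _)
  have hinj : Set.InjOn x (Finset.range (k + 1)) := by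
    intro i hi j hj hij
    simp only [Finset.coe_range, Set.mem_Iio] at hi hj
    have := hdist i (by omega) j (by omega)
    rw [hij, sub_self, abs_zero] at this
    have h0 : |(i : ℝ) - j| = 0 := le_antisymm (by nlinarith) (abs_nonneg _)
    exact_mod_cast sub_eq_zero.1 (abs_eq_zero.1 h0)
  -- Rolle is applied to `u 0` minus its Lagrange interpolant at the k+1 points. The k-th derivative
  -- of the interpolant is the constant k! times its top coefficient, a divided difference of the
  -- values `u 0 (x i)`.
  set p : Polynomial ℝ := Lagrange.interpolate (Finset.range (k + 1)) x (fun i => u 0 (x i)) with hp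
  have hpdeg : p.degree < (Finset.range (k + 1)).card := Lagrange.degree_interpolate_lt _ hinj
  have hpe : ∀ i ≤ k, p.eval (x i) = u 0 (x i) := fun i hi =>
    Lagrange.eval_interpolate_at_node _ hinj (Finset.mem_range.2 (by omega))
  obtain ⟨ξ, hξ, hξ0⟩ := exists_zero_of_zeros hI k
    (fun j t => u j t - (Polynomial.derivative^[j] p).eval t)
    (fun j hj t ht => by
      rw [Function.iterate_succ_apply']
      exact (hu j hj t ht).sub (Polynomial.hasDerivAt _ t)) x
    (fun i hi => by linarith [hx i hi]) hxI (fun i hi => by simp [hpe i hi])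
  have hnat : p.natDegree ≤ k := by
    rw [Finset.card_range] at hpdeg
    exact Polynomial.natDegree_le_iff_degree_le.2 (Order.lt_succ_iff.1 (by exact_mod_cast hpdeg))
  have hder : (Polynomial.derivative^[k] p).eval ξ = k.factorial * p.coeff k := by
    have h1 : (Polynomial.derivative^[k] p).natDegree ≤ 0 := by
      have := Polynomial.natDegree_iterate_derivative p k
      omega
    rw [Polynomial.eq_C_of_natDegree_le_zero h1, Polynomial.eval_C, Polynomial.coeff_iterate_derivative]
    simp [Nat.descFactorial_self]
  have hcoeff : p.coeff k = ∑ i ∈ Finset.range (k + 1),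
      u 0 (x i) / ∏ j ∈ (Finset.range (k + 1)).erase i, (x i - x j) := by
    have := Lagrange.coeff_eq_sum (P := p) hinj (by simpa using hpdeg)
    rw [Finset.card_range, Nat.add_sub_cancel] at this
    rw [this]
    refine Finset.sum_congr rfl fun i hi => ?_
    rw [hpe i (by rw [Finset.mem_range] at hi; omega)]
  refine ⟨ξ, hξ, ?_⟩
  have hε : 0 ≤ ε := (abs_nonneg _).trans (hxε 0 (by omega))
  rw [sub_eq_zero.1 hξ0, hder, hcoeff, abs_mul, Nat.abs_cast]
  have hterm : ∀ i ∈ Finset.range (k + 1),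
      |u 0 (x i) / ∏ j ∈ (Finset.range (k + 1)).erase i, (x i - x j)|
        ≤ ε / h ^ k * ((k.choose i : ℝ) / k.factorial) := by
    intro i hi
    have hik : i ≤ k := by rw [Finset.mem_range] at hi; omega
    have hprod : h ^ k * ((i.factorial : ℝ) * (k - i).factorial) ≤
        ∏ j ∈ (Finset.range (k + 1)).erase i, |x i - x j| := by
      rw [← prod_erase_abs_sub k i hik]
      have hcard : ((Finset.range (k + 1)).erase i).card = k := by
        rw [Finset.card_erase_of_mem hi]; simp
      rw [← hcard, ← Finset.prod_const, hcard, ← Finset.prod_mul_distrib]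
      refine Finset.prod_le_prod (fun j _ => by positivity) fun j hj => hdist i hik j ?_
      have := Finset.mem_of_mem_erase hj
      rw [Finset.mem_range] at this; omega
    rw [abs_div, Finset.abs_prod]
    calc |u 0 (x i)| / _ ≤ ε / (h ^ k * ((i.factorial : ℝ) * (k - i).factorial)) :=
          div_le_div₀ hε (hxε i hik) (by positivity) hprod
      _ = _ := by
          rw [Nat.cast_choose ℝ hik]
          field_simp
  calc (k.factorial : ℝ) * |_| * h ^ k
      ≤ k.factorial * (∑ i ∈ Finset.range (k + 1), ε / h ^ k * ((k.choose i : ℝ) / k.factorial))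
        * h ^ k := by
        gcongr
        exact (Finset.abs_sum_le_sum_abs _ _).trans (Finset.sum_le_sum hterm)
    _ = 2 ^ k * ε := by
        rw [← Finset.mul_sum, ← Finset.sum_div]
        have : ∑ i ∈ Finset.range (k + 1), (k.choose i : ℝ) = 2 ^ k := by
          exact_mod_cast Nat.sum_range_choose k
        rw [this]
        field_simp

/-- A bounded below set of measure larger than `k * h` contains `k + 1` points with spacings at
least `h`. -/
theorem exists_spaced_points {h : ℝ} (hh : 0 < h) : ∀ (k : ℕ) (E : Set ℝ), BddBelow E →
    ENNReal.ofReal (k * h) < volume E →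
    ∃ x : ℕ → ℝ, (∀ i < k, x i + h ≤ x (i + 1)) ∧ ∀ i ≤ k, x i ∈ E := by
  intro k
  induction k with
  | zero =>
    intro E _ hE
    obtain ⟨t, ht⟩ := nonempty_of_measure_ne_zero (by simpa using hE.ne' : volume E ≠ 0)
    exact ⟨fun _ => t, by simp, fun _ _ => ht⟩
  | succ k ih =>
    intro E hbdd hE
    have hne : E.Nonempty := nonempty_of_measure_ne_zero (pos_of_gt hE).ne'
    -- The infimum of `E` need not be attained. The first point is taken within η of it, and
    -- discarding the part of `E` below `x₀ + h` then costs at most h + η.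
    obtain ⟨η, hη, hEη⟩ : ∃ η > 0, ENNReal.ofReal ((k + 1) * h + η) < volume E := by
      have hcont : Tendsto (fun η : ℝ => ENNReal.ofReal ((k + 1) * h + η)) (𝓝[>] 0)
          (𝓝 (ENNReal.ofReal ((k + 1) * h + 0))) :=
        ((ENNReal.continuous_ofReal.comp (by fun_prop : Continuous fun η : ℝ => (k + 1) * h + η)).tendsto
          0).mono_left nhdsWithin_le_nhds
      have h1 := hcont.eventually_lt_const (by simpa using hE)
      obtain ⟨η, h2, h3⟩ := (h1.and self_mem_nhdsWithin).exists
      exact ⟨η, h3, h2⟩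
    obtain ⟨x₀, hx₀, hx₀'⟩ := exists_lt_of_csInf_lt hne (lt_add_of_pos_right (sInf E) hη)
    have hsub : E ⊆ Set.Icc (sInf E) (x₀ + h) ∪ (E ∩ Set.Ici (x₀ + h)) := by
      intro t ht
      rcases le_total t (x₀ + h) with h1 | h1
      · exact Or.inl ⟨csInf_le hbdd ht, h1⟩
      · exact Or.inr ⟨ht, h1⟩
    have hmes : ENNReal.ofReal (k * h) < volume (E ∩ Set.Ici (x₀ + h)) := by
      have h1 : volume E ≤ ENNReal.ofReal (η + h) + volume (E ∩ Set.Ici (x₀ + h)) := by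
        refine (measure_mono hsub).trans ((measure_union_le _ _).trans ?_)
        gcongr
        rw [Real.volume_Icc]
        exact ENNReal.ofReal_le_ofReal (by linarith)
      by_contra hcon
      rw [not_lt] at hcon
      have h2 : volume E ≤ ENNReal.ofReal ((k + 1) * h + η) := by
        refine h1.trans ((add_le_add le_rfl hcon).trans ?_)
        rw [← ENNReal.ofReal_add (by positivity) (by positivity)]
        exact ENNReal.ofReal_le_ofReal (by linarith)
      exact absurd hEη (not_lt.2 h2)
    obtain ⟨x, hx, hxE⟩ := ih _ (hbdd.mono Set.inter_subset_left) hmes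
    refine ⟨fun i => Nat.casesOn i x₀ x, ?_, ?_⟩
    · intro i hi
      cases i with
      | zero => exact (hxE 0 (by omega)).2
      | succ i => exact hx i (by omega)
    · intro i hi
      cases i with
      | zero => exact hx₀
      | succ i => exact (hxE i (by omega)).1

/-- Measure of a sublevel set of a function whose `k`-th derivative is bounded away from `0`. -/
theorem volume_sublevel_le {I : Set ℝ} (hI : I.OrdConnected) (hIb : BddBelow I) {k : ℕ}
    {u : ℕ → ℝ → ℝ} (hu : ∀ j < k, ∀ t ∈ I, HasDerivAt (u j) (u (j + 1) t) t) {c ε h : ℝ}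
    (hc : ∀ t ∈ I, c ≤ |u k t|) (hh : 0 < h) (hlt : 2 ^ k * ε < c * h ^ k) {E : Set ℝ}
    (hE : E ⊆ I) (hEε : ∀ t ∈ E, |u 0 t| ≤ ε) : volume E ≤ ENNReal.ofReal (k * h) := by
  by_contra hcon
  obtain ⟨x, hx, hxE⟩ := exists_spaced_points hh k E (hIb.mono hE) (not_le.1 hcon)
  obtain ⟨ξ, hξ, hξ'⟩ := exists_abs_deriv_le hI hu hh hx (fun i hi => hE (hxE i hi))
    (fun i hi => hEε _ (hxE i hi))
  have := mul_le_mul_of_nonneg_right (hc ξ hξ) (by positivity : 0 ≤ h ^ k)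
  linarith

/-! ### Symmetry of higher real derivatives. -/

section SymmetricDerivatives

variable {E F : Type*} [NormedAddCommGroup E] [NormedSpace ℝ E]
  [NormedAddCommGroup F] [NormedSpace ℝ F]

theorem fderiv_iteratedFDeriv_apply {n : ℕ} {h : E → F} {y : E}
    (hd : DifferentiableAt ℝ (iteratedFDeriv ℝ n h) y) (w : Fin n → E) (b : E) :
    fderiv ℝ (iteratedFDeriv ℝ n h) y b w = fderiv ℝ (fun z => iteratedFDeriv ℝ n h z w) y b := by
  have := ((ContinuousMultilinearMap.apply ℝ (fun _ : Fin n => E) F w).hasFDerivAt.comp y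
    hd.hasFDerivAt).fderiv
  change _ = fderiv ℝ ((ContinuousMultilinearMap.apply ℝ (fun _ : Fin n => E) F w) ∘
    iteratedFDeriv ℝ n h) y b
  rw [this]
  rfl

theorem iteratedFDeriv_add_two_apply {n : ℕ} {h : E → F} {y : E}
    (hh : ContDiffAt ℝ (n + 1 + 1 : ℕ) h y) (w : Fin (n + 1 + 1) → E) :
    iteratedFDeriv ℝ (n + 1 + 1) h y w =
      fderiv ℝ (fderiv ℝ (iteratedFDeriv ℝ n h)) y (w 0) (w 1) (Fin.tail (Fin.tail w)) := by
  have hd : ContDiffAt ℝ 2 (iteratedFDeriv ℝ n h) y :=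
    hh.iteratedFDeriv_right (by norm_cast; omega)
  have hd1 : DifferentiableAt ℝ (fderiv ℝ (iteratedFDeriv ℝ n h)) y :=
    (hd.fderiv_right (m := 1) (by norm_num)).differentiableAt (by simp)
  rw [iteratedFDeriv_succ_apply_left, fderiv_iteratedFDeriv_apply
    (hh.differentiableAt_iteratedFDeriv (by norm_cast; omega))]
  have hK := hd1.hasFDerivAt.clm_apply (hasFDerivAt_const (w 1) y)
  have hL := ((ContinuousMultilinearMap.apply ℝ (fun _ : Fin n => E) F
    (Fin.tail (Fin.tail w))).hasFDerivAt.comp y hK).fderiv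
  change fderiv ℝ ((ContinuousMultilinearMap.apply ℝ (fun _ : Fin n => E) F
    (Fin.tail (Fin.tail w))) ∘ fun z => fderiv ℝ (iteratedFDeriv ℝ n h) z (w 1)) y (w 0) = _
  rw [hL]
  simp

/-- The iterated derivative of a `C^n` function is symmetric. -/
theorem iteratedFDeriv_comp_perm_of_contDiffAt {n : ℕ} {h : E → F} {y : E} (hh : ContDiffAt ℝ n h y)
    (v : Fin n → E) (σ : Equiv.Perm (Fin n)) :
    iteratedFDeriv ℝ n h y (v ∘ σ) = iteratedFDeriv ℝ n h y v := by
  induction n generalizing y with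
  | zero => congr 1; exact Subsingleton.elim _ _
  | succ n ih =>
    -- Adjacent transpositions generate the group. The one exchanging slots 0 and 1 is the symmetry
    -- of a second derivative; the others fix slot 0 and follow by differentiating the induction
    -- hypothesis, which holds at all nearby points.
    have hσ : σ ∈ Submonoid.closure
        (Set.range fun i : Fin n => Equiv.swap i.castSucc i.succ) := by
      rw [Equiv.Perm.mclosure_swap_castSucc_succ]; trivial
    induction hσ using Submonoid.closure_induction generalizing v with
    | one => rfl
    | mul σ τ _ _ h1 h2 =>
      rw [Equiv.Perm.coe_mul, ← Function.comp_assoc, h2, h1]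
    | mem σ hσ =>
      obtain ⟨i, rfl⟩ := hσ
      obtain ⟨n, rfl⟩ : ∃ m, n = m + 1 := ⟨n - 1, by have := i.pos; omega⟩
      refine Fin.cases ?_ (fun j => ?_) i
      · have hd : ContDiffAt ℝ 2 (iteratedFDeriv ℝ n h) y :=
          hh.iteratedFDeriv_right (by norm_cast; omega)
        have hsym := hd.isSymmSndFDerivAt (by simp)
        have htail : Fin.tail (Fin.tail (v ∘ Equiv.swap (0 : Fin (n + 1)).castSucc
            (0 : Fin (n + 1)).succ)) = Fin.tail (Fin.tail v) := by
          funext k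
          have : Equiv.swap (0 : Fin (n + 1)).castSucc (0 : Fin (n + 1)).succ k.succ.succ =
              k.succ.succ :=
            Equiv.swap_apply_of_ne_of_ne (by simp [Fin.ext_iff]) (by simp [Fin.ext_iff])
          simp only [Fin.tail, Function.comp, this]
        rw [iteratedFDeriv_add_two_apply hh, iteratedFDeriv_add_two_apply hh, htail, hsym.eq]
        rfl
      · have hev : ∀ᶠ z in 𝓝 y, ContDiffAt ℝ (n + 1 : ℕ) h z :=
          (hh.of_le (by norm_cast; omega)).eventually (by simp)
        have htail : Fin.tail (v ∘ Equiv.swap j.succ.castSucc j.succ.succ) =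
            Fin.tail v ∘ Equiv.swap j.castSucc j.succ := by
          funext k
          simp only [Fin.tail, Function.comp]
          rw [← (Fin.succ_injective _).swap_apply, Fin.succ_castSucc]
        have heq : (fun z => iteratedFDeriv ℝ (n + 1) h z
            (Fin.tail (v ∘ Equiv.swap j.succ.castSucc j.succ.succ))) =ᶠ[𝓝 y]
            fun z => iteratedFDeriv ℝ (n + 1) h z (Fin.tail v) := by
          filter_upwards [hev] with z hz
          rw [htail, ih hz]
        have hd : DifferentiableAt ℝ (iteratedFDeriv ℝ (n + 1) h) y :=
          hh.differentiableAt_iteratedFDeriv (by norm_cast; omega)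
        have h0 : Equiv.swap j.succ.castSucc j.succ.succ 0 = 0 :=
          Equiv.swap_apply_of_ne_of_ne (by simp [Fin.ext_iff]) (by simp [Fin.ext_iff])
        rw [iteratedFDeriv_succ_apply_left, iteratedFDeriv_succ_apply_left,
          fderiv_iteratedFDeriv_apply hd, fderiv_iteratedFDeriv_apply hd, heq.fderiv_eq,
          Function.comp_apply, h0]

end SymmetricDerivatives

/-! ### Smoothness of holomorphic maps of several variables. -/

section Holomorphic

variable {E F : Type*} [NormedAddCommGroup E] [NormedSpace ℂ E] [FiniteDimensional ℂ E]
  [NormedAddCommGroup F] [NormedSpace ℂ F] [FiniteDimensional ℂ F]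

/-- On the complex line through z in direction v, Cauchy's formula writes the derivative as a circle
integral of `f`, which can be differentiated under the integral sign. The circle stays in the ball
of radius 2R; the remaining collar of width R provides the Cauchy estimate that dominates the
differentiated integrand. -/
theorem differentiableOn_fderiv_apply {U : Set E} (hU : IsOpen U) {f : E → F}
    (hf : DifferentiableOn ℂ f U) (v : E) : DifferentiableOn ℂ (fun z => fderiv ℂ f z v) U := by
  have : CompleteSpace F := FiniteDimensional.complete ℂ F
  have : ProperSpace E := FiniteDimensional.proper ℂ E
  borelize E F (E →L[ℂ] F)
  intro z₀ hz₀
  obtain ⟨R', hR', hR'U⟩ := Metric.isOpen_iff.1 hU z₀ hz₀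
  obtain ⟨R, hR, hRU⟩ : ∃ R > 0, Metric.closedBall z₀ (3 * R) ⊆ U :=
    ⟨R' / 6, by positivity, (Metric.closedBall_subset_ball (by linarith)).trans hR'U⟩
  obtain ⟨r, hr, hrv⟩ : ∃ r > 0, r * ‖v‖ ≤ R :=
    ⟨R / (‖v‖ + 1), by positivity, by
      rw [div_mul_eq_mul_div, div_le_iff₀ (by positivity)]; nlinarith [norm_nonneg v]⟩
  obtain ⟨M, hM⟩ := (isCompact_closedBall z₀ (3 * R)).exists_bound_of_continuousOn
    (hf.continuousOn.mono hRU)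
  have hM0 : 0 ≤ M := (norm_nonneg _).trans (hM z₀ (Metric.mem_closedBall_self (by positivity)))
  have hfat : ∀ z ∈ Metric.closedBall z₀ (3 * R), DifferentiableAt ℂ f z := fun z hz =>
    (hf z (hRU hz)).differentiableAt (hU.mem_nhds (hRU hz))
  have hbound : ∀ z ∈ Metric.closedBall z₀ (2 * R), ‖fderiv ℂ f z‖ ≤ (2 * M + 1) / R := by
    intro z hz
    have hsub : Metric.ball z R ⊆ Metric.closedBall z₀ (3 * R) := fun w hw => by
      rw [Metric.mem_closedBall] at hz ⊢
      rw [Metric.mem_ball] at hw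
      linarith [dist_triangle w z z₀]
    refine Complex.norm_fderiv_le_div_of_mapsTo_ball (hf.mono (hsub.trans hRU)) ?_ hR
    intro w hw
    rw [Metric.mem_closedBall, dist_eq_norm]
    have h1 := norm_sub_le (f w) (f z)
    have h2 := hM w (hsub hw)
    have h3 := hM z (hsub (Metric.mem_ball_self hR))
    linarith
  set c : ℝ → ℂ := fun θ => deriv (circleMap 0 r) θ * ((circleMap 0 r θ) ^ 2)⁻¹ with hc
  have hcc : Continuous c := by
    have h1 : ∀ θ, circleMap 0 r θ ^ 2 ≠ 0 := fun θ => pow_ne_zero _ (circleMap_ne_center hr.ne')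
    simp only [hc, deriv_circleMap]
    exact ((continuous_circleMap 0 r).mul continuous_const).mul
      (((continuous_circleMap 0 r).pow 2).inv₀ h1)
  have hmem : ∀ z ∈ Metric.ball z₀ R, ∀ t : ℂ, ‖t‖ ≤ r →
      z + t • v ∈ Metric.closedBall z₀ (2 * R) := by
    intro z hz t ht
    rw [Metric.mem_ball, dist_eq_norm] at hz
    rw [Metric.mem_closedBall, dist_eq_norm]
    calc ‖z + t • v - z₀‖ = ‖(z - z₀) + t • v‖ := by congr 1; abel
      _ ≤ ‖z - z₀‖ + ‖t‖ * ‖v‖ := (norm_add_le _ _).trans (by rw [norm_smul])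
      _ ≤ R + r * ‖v‖ := by gcongr
      _ ≤ 2 * R := by linarith
  have hsub23 : Metric.closedBall z₀ (2 * R) ⊆ Metric.closedBall z₀ (3 * R) :=
    Metric.closedBall_subset_closedBall (by linarith)
  have hnorm : ∀ θ, ‖circleMap 0 r θ‖ ≤ r := fun θ => by simp [abs_of_pos hr]
  have hformula : ∀ z ∈ Metric.ball z₀ R, fderiv ℂ f z v = (2 * Real.pi * Complex.I : ℂ)⁻¹ •
      ∫ θ in (0 : ℝ)..2 * Real.pi, c θ • f (z + circleMap 0 r θ • v) := by
    intro z hz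
    have hline : Continuous fun t : ℂ => z + t • v := by fun_prop
    set g : ℂ → F := fun t => f (z + t • v) with hg
    have hgd : DifferentiableOn ℂ g ((fun t : ℂ => z + t • v) ⁻¹' U) := by
      refine hf.comp ?_ (fun t ht => ht)
      fun_prop
    have h0 := Complex.two_pi_I_inv_smul_circleIntegral_sub_sq_inv_smul_of_differentiable
      (hU.preimage hline) (c := 0) (w₀ := 0) (R := r)
      (fun t ht => hRU (hsub23 (hmem z hz t (by simpa using ht)))) hgd (Metric.mem_ball_self hr)
    have hder : deriv g 0 = fderiv ℂ f z v := by
      have h1 : HasDerivAt (fun t : ℂ => z + t • v) v 0 := by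
        simpa using ((hasDerivAt_id (0 : ℂ)).smul_const v).const_add z
      have h2 : HasFDerivAt f (fderiv ℂ f z) (z + (0 : ℂ) • v) := by
        rw [zero_smul, add_zero]
        exact (hfat z (hsub23 (by simpa using hmem z hz 0 (by simpa using hr.le)))).hasFDerivAt
      exact (h2.comp_hasDerivAt (0 : ℂ) h1).deriv
    rw [← hder, ← h0, circleIntegral]
    simp only [sub_zero, smul_smul, hc, hg]
  have hder := intervalIntegral.hasFDerivAt_integral_of_dominated_of_fderiv_le (𝕜 := ℂ)
    (μ := volume) (a := 0) (b := 2 * Real.pi)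
    (F := fun z θ => c θ • f (z + circleMap 0 r θ • v))
    (F' := fun z θ => c θ • fderiv ℂ f (z + circleMap 0 r θ • v)) (x₀ := z₀)
    (bound := fun θ => ‖c θ‖ * ((2 * M + 1) / R)) (Metric.ball_mem_nhds z₀ hR) ?_ ?_ ?_ ?_ ?_ ?_
  · refine (DifferentiableAt.congr_of_eventuallyEq (hder.differentiableAt.const_smul
      ((2 * Real.pi * Complex.I : ℂ)⁻¹))
      ?_).differentiableWithinAt
    filter_upwards [Metric.ball_mem_nhds z₀ hR] with z hz using hformula z hz
  · filter_upwards [Metric.ball_mem_nhds z₀ hR] with z hz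
    refine Continuous.aestronglyMeasurable ?_
    exact hcc.smul (hf.continuousOn.comp_continuous
      (continuous_const.add ((continuous_circleMap 0 r).smul continuous_const))
      (fun θ => hRU (hsub23 (hmem z hz _ (hnorm θ)))))
  · refine Continuous.intervalIntegrable ?_ _ _
    exact hcc.smul (hf.continuousOn.comp_continuous
      (continuous_const.add ((continuous_circleMap 0 r).smul continuous_const))
      (fun θ => hRU (hsub23 (hmem z₀ (Metric.mem_ball_self hR) _ (hnorm θ)))))
  · refine hcc.aestronglyMeasurable.smul ?_
    have : SecondCountableTopology (E →L[ℂ] F) := inferInstance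
    refine ((measurable_fderiv ℂ f).comp ?_).aestronglyMeasurable
    exact (continuous_const.add ((continuous_circleMap 0 r).smul continuous_const)).measurable
  · refine Eventually.of_forall fun θ _ z hz => ?_
    rw [norm_smul]
    gcongr
    exact hbound _ (hmem z hz _ (hnorm θ))
  · exact (hcc.norm.mul continuous_const).intervalIntegrable _ _
  · refine Eventually.of_forall fun θ _ z hz => ?_
    have h1 : HasFDerivAt (fun z => z + circleMap 0 r θ • v) (ContinuousLinearMap.id ℂ E) z :=
      (hasFDerivAt_id z).add_const _
    have h2 := (hfat _ (hsub23 (hmem z hz _ (hnorm θ)))).hasFDerivAt.comp z h1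
    rw [ContinuousLinearMap.comp_id] at h2
    exact h2.const_smul (c θ)

/-- Holomorphic maps on open subsets of finite-dimensional spaces are smooth. -/
theorem contDiffOn_of_differentiableOn_complex {U : Set E} (hU : IsOpen U) {f : E → F}
    (hf : DifferentiableOn ℂ f U) (m : ℕ) : ContDiffOn ℂ m f U := by
  induction m generalizing f with
  | zero => exact contDiffOn_zero.2 hf.continuousOn
  | succ m ih =>
    push_cast
    rw [contDiffOn_succ_iff_fderiv_apply hU.uniqueDiffOn]
    refine ⟨hf, by simp, fun v => ?_⟩
    refine (ih (differentiableOn_fderiv_apply hU hf v)).congr fun z hz => ?_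
    rw [fderivWithin_of_isOpen hU hz]

end Holomorphic

/-! ### Polarization of symmetric multilinear maps. -/

section Polarization

variable {E F : Type*} [NormedAddCommGroup E] [NormedSpace ℝ E]
  [NormedAddCommGroup F] [NormedSpace ℝ F]

/-- The value `q ^ q / q!` of the polarization constant of symmetric `q`-linear maps. -/
noncomputable def polarConst (q : ℕ) : ℝ := (q : ℝ) ^ q / q.factorial

/-- The sum factors over the indices i, each appearing with exponent 1 plus the size of its fibre.
An index missed by κ has exponent 1 and contributes 1 + (-1) = 0; for bijective κ every exponent is
2. -/
theorem sum_signs_prod {q : ℕ} (κ : Fin q → Fin q) :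
    ∑ e ∈ Fintype.piFinset (fun _ : Fin q => ({1, -1} : Finset ℝ)),
      (∏ i, e i) * ∏ m, e (κ m) = if Function.Bijective κ then 2 ^ q else 0 := by
  have h1 : ∀ e : Fin q → ℝ, (∏ i, e i) * ∏ m, e (κ m) =
      ∏ i, e i ^ (1 + (Finset.univ.filter (fun m => κ m = i)).card) := by
    intro e
    rw [← Finset.prod_fiberwise (s := Finset.univ) (g := κ) (f := fun m => e (κ m)),
      ← Finset.prod_mul_distrib]
    refine Finset.prod_congr rfl fun i _ => ?_
    rw [pow_add, pow_one, Finset.prod_congr rfl (g := fun _ => e i), Finset.prod_const]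
    intro m hm
    rw [(Finset.mem_filter.1 hm).2]
  simp_rw [h1]
  rw [← Finset.prod_univ_sum (fun _ : Fin q => ({1, -1} : Finset ℝ))
    (fun i x => x ^ (1 + (Finset.univ.filter (fun m => κ m = i)).card))]
  simp_rw [Finset.sum_pair (show (1 : ℝ) ≠ -1 by norm_num)]
  split_ifs with hκ
  · rw [Finset.prod_congr rfl (g := fun _ => (2 : ℝ)), Finset.prod_const, Finset.card_univ,
      Fintype.card_fin]
    intro i _
    obtain ⟨m, rfl⟩ := hκ.2 i
    have : (Finset.univ.filter (fun m' => κ m' = κ m)) = {m} := by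
      ext m'; simp [hκ.1.eq_iff]
    rw [this]; norm_num
  · have hns : ¬ Function.Surjective κ := fun h => hκ (Finite.surjective_iff_bijective.1 h)
    simp only [Function.Surjective, not_forall, not_exists] at hns
    obtain ⟨i, hi⟩ := hns
    refine Finset.prod_eq_zero (Finset.mem_univ i) ?_
    have : (Finset.univ.filter (fun m => κ m = i)) = ∅ := by
      ext m; simp [hi m]
    rw [this]; norm_num

/-- A symmetric multilinear map is bounded on unit vectors by `q ^ q / q!` times its bound on the
diagonal. -/
theorem norm_symm_multilinear_le {q : ℕ} (T : ContinuousMultilinearMap ℝ (fun _ : Fin q => E) F)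
    (hT : ∀ (v : Fin q → E) (σ : Equiv.Perm (Fin q)), T (v ∘ σ) = T v) {C : ℝ}
    (hC : ∀ a : E, ‖T fun _ => a‖ ≤ C * ‖a‖ ^ q) (v : Fin q → E) (hv : ∀ i, ‖v i‖ ≤ 1) (hC0 : 0 ≤ C) :
    ‖T v‖ ≤ polarConst q * C := by
  have hexp : ∀ e : Fin q → ℝ, (T fun _ => ∑ i, e i • v i) =
      ∑ κ : Fin q → Fin q, (∏ m, e (κ m)) • T (v ∘ κ) := by
    intro e
    rw [T.map_sum]
    refine Finset.sum_congr rfl fun κ _ => ?_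
    rw [← T.map_smul_univ]
    rfl
  have hpol : ∑ e ∈ Fintype.piFinset (fun _ : Fin q => ({1, -1} : Finset ℝ)),
      (∏ i, e i) • (T fun _ => ∑ i, e i • v i) = ((2 : ℝ) ^ q * q.factorial) • T v := by
    simp_rw [hexp, Finset.smul_sum, smul_smul]
    rw [Finset.sum_comm]
    simp_rw [← Finset.sum_smul, sum_signs_prod, ite_smul, zero_smul]
    rw [← Finset.sum_filter]
    have hterm : ∀ κ ∈ Finset.univ.filter (fun κ : Fin q → Fin q => Function.Bijective κ),
        ((2 : ℝ) ^ q) • T (v ∘ κ) = (2 ^ q : ℝ) • T v := by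
      intro κ hκ
      have hb := (Finset.mem_filter.1 hκ).2
      rw [← hT v (Equiv.ofBijective κ hb)]
      rfl
    rw [Finset.sum_congr rfl hterm, Finset.sum_const]
    have hcard : (Finset.univ.filter (fun κ : Fin q → Fin q => Function.Bijective κ)).card
        = q.factorial := by
      rw [← Fintype.card_subtype, Fintype.card_congr
        (Equiv.ofBijective (fun κ : {κ : Fin q → Fin q // Function.Bijective κ} =>
          Equiv.ofBijective κ.1 κ.2) ⟨fun a b h => Subtype.ext (congrArg (fun e : Equiv.Perm (Fin q) => (e : Fin q → Fin q)) h),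
            fun σ => ⟨⟨σ, σ.bijective⟩, Equiv.ext fun _ => rfl⟩⟩), Fintype.card_perm, Fintype.card_fin]
    rw [hcard, ← Nat.cast_smul_eq_nsmul ℝ, smul_smul, mul_comm]
  have hbound : ‖((2 : ℝ) ^ q * q.factorial) • T v‖ ≤ 2 ^ q * (C * (q : ℝ) ^ q) := by
    rw [← hpol]
    refine (norm_sum_le _ _).trans ?_
    have hcard : (Fintype.piFinset (fun _ : Fin q => ({1, -1} : Finset ℝ))).card = 2 ^ q := by
      rw [Fintype.card_piFinset, Finset.prod_const, Finset.card_univ, Fintype.card_fin,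
        Finset.card_pair (by norm_num)]
    have : ∀ e ∈ Fintype.piFinset (fun _ : Fin q => ({1, -1} : Finset ℝ)),
        ‖(∏ i, e i) • (T fun _ => ∑ i, e i • v i)‖ ≤ C * (q : ℝ) ^ q := by
      intro e he
      have he1 : ∀ i, ‖e i‖ = 1 := by
        intro i
        have := Fintype.mem_piFinset.1 he i
        simp only [Finset.mem_insert, Finset.mem_singleton] at this
        rcases this with h | h <;> simp [h]
      rw [norm_smul, norm_prod, Finset.prod_congr rfl (fun i _ => he1 i), Finset.prod_const_one,
        one_mul]
      refine (hC _).trans ?_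
      gcongr
      refine (norm_sum_le _ _).trans ?_
      calc ∑ i, ‖e i • v i‖ ≤ ∑ _i : Fin q, (1 : ℝ) := by
            refine Finset.sum_le_sum fun i _ => ?_
            rw [norm_smul, he1, one_mul]; exact hv i
        _ = q := by simp
    refine (Finset.sum_le_card_nsmul _ _ _ this).trans ?_
    rw [hcard, nsmul_eq_mul]; push_cast; rfl
  rw [norm_smul, Real.norm_of_nonneg (by positivity), mul_assoc] at hbound
  have h2 := le_of_mul_le_mul_left hbound (by positivity)
  rw [polarConst, div_mul_eq_mul_div, le_div_iff₀ (by positivity)]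
  linarith

theorem two_pow_le_polarConst (q : ℕ) : (2 : ℝ) ^ q ≤ polarConst (q + 1) := by
  induction q with
  | zero => simp [polarConst]
  | succ q ih =>
    have h1 : polarConst (q + 1 + 1) = polarConst (q + 1) * ((1 + 1 / ((q : ℝ) + 1)) ^ (q + 1)) := by
      rw [polarConst, polarConst, Nat.factorial_succ (q + 1)]
      have : (1 + 1 / ((q : ℝ) + 1)) = (q + 2) / (q + 1) := by field_simp; ring
      rw [this, div_pow]
      push_cast
      have : (q : ℝ) + 1 ≠ 0 := by positivity
      have : (q : ℝ) + 2 ≠ 0 := by positivity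
      field_simp
      ring
    have h2 : 1 + ((q + 1 : ℕ) : ℝ) * (1 / ((q : ℝ) + 1)) ≤ (1 + 1 / ((q : ℝ) + 1)) ^ (q + 1) :=
      one_add_mul_le_pow (by
        have : (0 : ℝ) ≤ 1 / ((q : ℝ) + 1) := by positivity
        linarith) _
    have h3 : ((q + 1 : ℕ) : ℝ) * (1 / ((q : ℝ) + 1)) = 1 := by push_cast; field_simp
    rw [h1, pow_succ]
    refine mul_le_mul ih (by linarith) (by norm_num) (by unfold polarConst; positivity)

theorem polarConst_nonneg (q : ℕ) : 0 ≤ polarConst q := by unfold polarConst; positivity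

theorem monotone_polarConst : Monotone polarConst := by
  refine monotone_nat_of_le_succ fun q => ?_
  unfold polarConst
  rw [div_le_div_iff₀ (by positivity) (by positivity), Nat.factorial_succ]
  have h : (q : ℝ) ^ q ≤ ((q + 1 : ℕ) : ℝ) ^ q := by gcongr; omega
  push_cast at h ⊢
  rw [pow_succ]
  have : (0 : ℝ) ≤ (q + 1) * q.factorial := by positivity
  nlinarith

end Polarization

/-! ### Derivatives along a fixed direction. -/

section Directional

variable {E F : Type*} [NormedAddCommGroup E] [NormedSpace ℝ E]
  [NormedAddCommGroup F] [NormedSpace ℝ F]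

/-- The `j`-th derivative of `h` at `y` in the direction `a`. -/
noncomputable def dirDeriv (j : ℕ) (h : E → F) (a y : E) : F := iteratedFDeriv ℝ j h y fun _ => a

theorem hasFDerivAt_dirDeriv {j : ℕ} {h : E → F} {y : E} (hh : ContDiffAt ℝ (j + 1) h y) (a : E) :
    HasFDerivAt (dirDeriv j h a)
      ((ContinuousMultilinearMap.apply ℝ (fun _ : Fin j => E) F (fun _ => a)).comp
        (fderiv ℝ (iteratedFDeriv ℝ j h) y)) y := by
  have hd : DifferentiableAt ℝ (iteratedFDeriv ℝ j h) y :=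
    hh.differentiableAt_iteratedFDeriv (by exact_mod_cast Nat.lt_succ_self j)
  exact ((ContinuousMultilinearMap.apply ℝ (fun _ : Fin j => E) F (fun _ => a)).hasFDerivAt).comp y
    hd.hasFDerivAt

theorem hasDerivAt_dirDeriv {j : ℕ} {h : E → F} {y a : E} {t : ℝ}
    (hh : ContDiffAt ℝ (j + 1) h (y + t • a)) :
    HasDerivAt (fun s : ℝ => dirDeriv j h a (y + s • a)) (dirDeriv (j + 1) h a (y + t • a)) t := by
  have h1 : HasDerivAt (fun s : ℝ => y + s • a) a t := by
    simpa using ((hasDerivAt_id t).smul_const a).const_add y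
  refine ((hasFDerivAt_dirDeriv hh a).comp_hasDerivAt t h1).congr_deriv ?_
  rw [dirDeriv, iteratedFDeriv_succ_apply_left]
  rfl

theorem iteratedDeriv_line {W : Set E} (hW : IsOpen W) {h : E → F} {p : ℕ}
    (hh : ContDiffOn ℝ p h W) (y a : E) {j : ℕ} (hj : j ≤ p) {t : ℝ} (ht : y + t • a ∈ W) :
    iteratedDeriv j (fun s : ℝ => h (y + s • a)) t = dirDeriv j h a (y + t • a) := by
  induction j generalizing t with
  | zero => simp [dirDeriv]
  | succ j ih =>
    rw [iteratedDeriv_succ]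
    have hT : {s : ℝ | y + s • a ∈ W} ∈ 𝓝 t :=
      (hW.preimage (by fun_prop : Continuous fun s : ℝ => y + s • a)).mem_nhds ht
    have heq : iteratedDeriv j (fun s : ℝ => h (y + s • a)) =ᶠ[𝓝 t]
        fun s => dirDeriv j h a (y + s • a) := by
      filter_upwards [hT] with s hs using ih (by omega) hs
    rw [heq.deriv_eq]
    refine (hasDerivAt_dirDeriv ?_).deriv
    exact (hh.contDiffAt (hW.mem_nhds ht)).of_le (by exact_mod_cast hj)

/-- Leibniz' inequality for derivatives in one direction. -/
theorem norm_dirDeriv_bilinear_le {G H : Type*} [NormedAddCommGroup G] [NormedSpace ℝ G]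
    [NormedAddCommGroup H] [NormedSpace ℝ H]
    (B : F →L[ℝ] G →L[ℝ] H) (hB : ‖B‖ ≤ 1) {W : Set E} (hW : IsOpen W) {u : E → F} {v : E → G} {k : ℕ}
    (hu : ContDiffOn ℝ k u W) (hv : ContDiffOn ℝ k v W) {y : E} (hy : y ∈ W) (a : E) :
    ‖dirDeriv k (fun z => B (u z) (v z)) a y‖ ≤ ∑ i ∈ Finset.range (k + 1),
      (k.choose i : ℝ) * ‖dirDeriv i u a y‖ * ‖dirDeriv (k - i) v a y‖ := by
  -- Restricting to the line y + s • a reduces to one real variable, so only derivatives along the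
  -- same a occur and no polarization constant is lost.
  have hcont : ContDiff ℝ k (fun s : ℝ => y + s • a) := by fun_prop
  set T : Set ℝ := {s : ℝ | y + s • a ∈ W} with hTdef
  have hT : IsOpen T := hW.preimage (by fun_prop : Continuous fun s : ℝ => y + s • a)
  have h0 : (0 : ℝ) ∈ T := by simpa [hTdef] using hy
  have huT : ContDiffOn ℝ k (fun s : ℝ => u (y + s • a)) T :=
    hu.comp hcont.contDiffOn fun s hs => hs
  have hvT : ContDiffOn ℝ k (fun s : ℝ => v (y + s • a)) T :=
    hv.comp hcont.contDiffOn fun s hs => hs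
  have hBW : ContDiffOn ℝ k (fun z => B (u z) (v z)) W :=
    B.isBoundedBilinearMap.contDiff.comp_contDiffOn (hu.prodMk hv)
  have key := B.norm_iteratedFDerivWithin_le_of_bilinear_of_le_one huT hvT hT.uniqueDiffOn h0
    (le_refl (k : WithTop ℕ∞)) hB
  have hconvH : ‖iteratedFDerivWithin ℝ k (fun s : ℝ => B (u (y + s • a)) (v (y + s • a))) T 0‖
      = ‖dirDeriv k (fun z => B (u z) (v z)) a y‖ := by
    rw [iteratedFDerivWithin_of_isOpen k hT h0, norm_iteratedFDeriv_eq_norm_iteratedDeriv,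
      iteratedDeriv_line hW hBW y a le_rfl (by simpa using hy)]
    simp
  rw [hconvH] at key
  refine key.trans (Finset.sum_le_sum fun i hi => ?_)
  have hi' : i ≤ k := by rw [Finset.mem_range] at hi; omega
  have e1 : ‖iteratedFDerivWithin ℝ i (fun s : ℝ => u (y + s • a)) T 0‖ = ‖dirDeriv i u a y‖ := by
    rw [iteratedFDerivWithin_of_isOpen i hT h0, norm_iteratedFDeriv_eq_norm_iteratedDeriv,
      iteratedDeriv_line hW hu y a hi' (by simpa using hy)]
    simp
  have e2 : ‖iteratedFDerivWithin ℝ (k - i) (fun s : ℝ => v (y + s • a)) T 0‖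
      = ‖dirDeriv (k - i) v a y‖ := by
    rw [iteratedFDerivWithin_of_isOpen (k - i) hT h0, norm_iteratedFDeriv_eq_norm_iteratedDeriv,
      iteratedDeriv_line hW hv y a (Nat.sub_le _ _) (by simpa using hy)]
    simp
  rw [e1, e2]

theorem dirDeriv_smul_dir (j : ℕ) (h : E → F) (c : ℝ) (a y : E) :
    dirDeriv j h (c • a) y = c ^ j • dirDeriv j h a y := by
  have := (iteratedFDeriv ℝ j h y).map_smul_univ (fun _ => c) (fun _ => a)
  simpa [dirDeriv] using this

/-- Variation of a directional derivative on a ball. -/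
theorem norm_dirDeriv_sub_le {h : E → F} {y y' : E} {r C : ℝ} {j : ℕ}
    (hh : ∀ z ∈ Metric.ball y r, ContDiffAt ℝ (j + 1 : ℕ) h z) (hC0 : 0 ≤ C)
    (hC : ∀ z ∈ Metric.ball y r, ∀ b : E, ‖b‖ = 1 → ‖dirDeriv (j + 1) h b z‖ ≤ C)
    (hy' : y' ∈ Metric.ball y r) {a : E} (ha : ‖a‖ = 1) :
    ‖dirDeriv j h a y' - dirDeriv j h a y‖ ≤ polarConst (j + 1) * C * r := by
  have hr : 0 < r := (dist_nonneg).trans_lt hy'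
  -- The derivative of `dirDeriv j h a` along b is D^(j+1)h(b, a, …, a); polarization bounds this
  -- mixed value by the diagonal ones.
  have hb : ∀ z ∈ Metric.ball y r,
      ‖(ContinuousMultilinearMap.apply ℝ (fun _ : Fin j => E) F (fun _ => a)).comp
        (fderiv ℝ (iteratedFDeriv ℝ j h) z)‖ ≤ polarConst (j + 1) * C := by
    intro z hz
    refine ContinuousLinearMap.opNorm_le_of_unit_norm
      (mul_nonneg (polarConst_nonneg _) hC0) fun b hb => ?_
    have : ((ContinuousMultilinearMap.apply ℝ (fun _ : Fin j => E) F (fun _ => a)).comp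
        (fderiv ℝ (iteratedFDeriv ℝ j h) z)) b =
        iteratedFDeriv ℝ (j + 1) h z (Fin.cons b fun _ => a) := rfl
    rw [this]
    refine norm_symm_multilinear_le _ (iteratedFDeriv_comp_perm_of_contDiffAt (hh z hz)) ?_ _ ?_ hC0
    · intro b
      rcases eq_or_ne b 0 with rfl | hb0
      · have : (iteratedFDeriv ℝ (j + 1) h z) (fun _ => (0 : E)) = 0 :=
          (iteratedFDeriv ℝ (j + 1) h z).map_coord_zero 0 rfl
        simp [this]
      · have h1 := hC z hz (‖b‖⁻¹ • b) (by rw [norm_smul, norm_inv, norm_norm,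
          inv_mul_cancel₀ (norm_ne_zero_iff.2 hb0)])
        have h2 : dirDeriv (j + 1) h b z = ‖b‖ ^ (j + 1) • dirDeriv (j + 1) h (‖b‖⁻¹ • b) z := by
          rw [← dirDeriv_smul_dir, smul_smul, mul_inv_cancel₀ (norm_ne_zero_iff.2 hb0), one_smul]
        change ‖dirDeriv (j + 1) h b z‖ ≤ _
        rw [h2, norm_smul, norm_pow, norm_norm, mul_comm]
        gcongr
    · intro i
      refine Fin.cases ?_ (fun i => ?_) i
      · simpa using hb.le
      · simpa using ha.le
  have := (convex_ball y r).norm_image_sub_le_of_norm_hasFDerivWithin_le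
    (fun z hz => (hasFDerivAt_dirDeriv (hh z hz) a).hasFDerivWithinAt) hb
    (Metric.mem_ball_self hr) hy'
  refine this.trans ?_
  have hd : ‖y' - y‖ ≤ r := by rw [← dist_eq_norm]; exact (Metric.mem_ball.1 hy').le
  exact mul_le_mul_of_nonneg_left hd (mul_nonneg (polarConst_nonneg _) hC0)

end Directional

/-! ### Sections of sublevel sets and the Leibniz estimates for |φ|². -/

section Sections

variable {E F : Type*} [NormedAddCommGroup E] [NormedSpace ℝ E]
  [NormedAddCommGroup F] [NormedSpace ℝ F]

theorem dirDeriv_sub {j : ℕ} {u v : E → F} {y : E} (hu : ContDiffAt ℝ j u y)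
    (hv : ContDiffAt ℝ j v y) (a : E) :
    dirDeriv j (fun z => u z - v z) a y = dirDeriv j u a y - dirDeriv j v a y := by
  have := iteratedFDeriv_sub_apply hu hv
  simp only [dirDeriv]
  rw [show (fun z => u z - v z) = u - v from rfl, this]
  rfl

theorem dirDeriv_const_smul {j : ℕ} {u : E → F} {y : E} (c : ℝ) (hu : ContDiffAt ℝ j u y) (a : E) :
    dirDeriv j (fun z => c • u z) a y = c • dirDeriv j u a y := by
  have := iteratedFDeriv_const_smul_apply (a := c) hu
  simp only [dirDeriv]
  rw [show (fun z => c • u z) = c • u from rfl, this]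
  rfl

theorem dirDeriv_clm_comp {G : Type*} [NormedAddCommGroup G] [NormedSpace ℝ G] (L : F →L[ℝ] G)
    {j : ℕ} {u : E → F} {y : E} (hu : ContDiffAt ℝ j u y) (a : E) :
    dirDeriv j (fun z => L (u z)) a y = L (dirDeriv j u a y) := by
  have := L.iteratedFDeriv_comp_left hu (le_refl (j : WithTop ℕ∞))
  simp only [dirDeriv]
  rw [show (fun z => L (u z)) = L ∘ u from rfl, this]
  rfl

/-- Sections of a sublevel set in a direction in which some derivative is large. -/
theorem volume_section_le {W : Set E} (hW : IsOpen W) {w : E → ℝ} {k : ℕ}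
    (hw : ContDiffOn ℝ k w W) {y : E} {r : ℝ} (hball : Metric.ball y r ⊆ W) {a : E} (ha : ‖a‖ = 1)
    {c ε h : ℝ} (hc : ∀ z ∈ Metric.ball y r, c ≤ |dirDeriv k w a z|) (hh : 0 < h)
    (hlt : 2 ^ k * ε < c * h ^ k) (z : E) {A : Set ℝ}
    (hA : ∀ t ∈ A, z + t • a ∈ Metric.ball y r ∧ |w (z + t • a)| ≤ ε) :
    volume A ≤ ENNReal.ofReal (k * h) := by
  set I : Set ℝ := {t : ℝ | z + t • a ∈ Metric.ball y r} with hI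
  have hIconv : Convex ℝ I := by
    intro s hs t ht α β hα hβ hαβ
    have := convex_ball y r hs ht hα hβ hαβ
    rw [hI, Set.mem_ofPred_eq]
    convert! this using 1
    rw [smul_add, smul_add, add_add_add_comm, ← add_smul, hαβ, one_smul, smul_smul, smul_smul,
      ← add_smul]
    rfl
  have hIb : BddBelow I := by
    refine ⟨-(‖y - z‖ + r), fun t ht => ?_⟩
    have h1 : ‖z + t • a - y‖ < r := by simpa [hI, dist_eq_norm] using ht
    have h2 : ‖t • a‖ ≤ ‖z + t • a - y‖ + ‖y - z‖ := by
      calc ‖t • a‖ = ‖(z + t • a - y) + (y - z)‖ := by congr 1; abel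
        _ ≤ _ := norm_add_le _ _
    rw [norm_smul, ha, mul_one, Real.norm_eq_abs] at h2
    linarith [neg_abs_le t]
  refine volume_sublevel_le (I := I) hIconv.ordConnected hIb
    (u := fun j t => dirDeriv j w a (z + t • a)) ?_ (fun t ht => hc _ ht) hh hlt
    (fun t ht => (hA t ht).1) ?_
  · intro j hj t ht
    exact hasDerivAt_dirDeriv (((hw.contDiffAt (hW.mem_nhds (hball ht)))).of_le
      (by exact_mod_cast hj))
  · intro t ht
    simpa [dirDeriv] using (hA t ht).2

/-- Pairing i with μ - i: one of the two is at most μ/2, so each pair is bounded by A + B instead of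
2B. This gain decides the top-order case. -/
theorem sum_choose_mul_le {μ : ℕ} {w : ℕ → ℝ} {A B : ℝ}
    (hA : ∀ i, 2 * i ≤ μ → w i ≤ A) (hB : ∀ i ≤ μ, w i ≤ B) :
    ∑ i ∈ Finset.range (μ + 1), (μ.choose i : ℝ) * w i ≤ 2 ^ μ * ((A + B) / 2) := by
  have hrefl : ∑ i ∈ Finset.range (μ + 1), (μ.choose i : ℝ) * w i =
      ∑ i ∈ Finset.range (μ + 1), (μ.choose i : ℝ) * w (μ - i) := by
    rw [← Finset.sum_range_reflect]
    refine Finset.sum_congr rfl fun i hi => ?_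
    rw [Finset.mem_range] at hi
    rw [show μ + 1 - 1 - i = μ - i by omega, Nat.choose_symm (by omega)]
  have hsum : ∑ i ∈ Finset.range (μ + 1), (μ.choose i : ℝ) * (w i + w (μ - i)) ≤
      ∑ i ∈ Finset.range (μ + 1), (μ.choose i : ℝ) * (A + B) := by
    refine Finset.sum_le_sum fun i hi => ?_
    rw [Finset.mem_range] at hi
    refine mul_le_mul_of_nonneg_left ?_ (Nat.cast_nonneg _)
    rcases le_total (2 * i) μ with h | h
    · exact add_le_add (hA i h) (hB _ (Nat.sub_le _ _))
    · rw [add_comm]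
      exact add_le_add (hA (μ - i) (by omega)) (hB _ (by omega))
  simp_rw [mul_add] at hsum
  rw [Finset.sum_add_distrib, ← hrefl] at hsum
  simp_rw [← mul_add] at hsum
  rw [← Finset.sum_mul] at hsum
  have : ∑ i ∈ Finset.range (μ + 1), (μ.choose i : ℝ) = 2 ^ μ := by
    exact_mod_cast Nat.sum_range_choose μ
  rw [this] at hsum
  linarith

theorem innerSL_complex_norm_le_one : ‖(innerSL ℝ : ℂ →L[ℝ] ℂ →L[ℝ] ℝ)‖ ≤ 1 :=
  norm_innerSL_le ℝ

/-- Effect on the derivatives of `|φ|²` of replacing `φ` by `φ - h`. -/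
theorem abs_dirDeriv_normSq_sub_le {W : Set E} (hW : IsOpen W) {φ φ' : E → ℂ} {k : ℕ}
    (hφ : ContDiffOn ℝ k φ W) (hφ' : ContDiffOn ℝ k φ' W) {z : E} (hz : z ∈ W) (a : E) {δ : ℝ}
    (hδ : ∀ j ≤ k, ‖dirDeriv j (fun z => φ z - φ' z) a z‖ ≤ δ) :
    |dirDeriv k (fun z => ‖φ z‖ ^ 2) a z - dirDeriv k (fun z => ‖φ' z‖ ^ 2) a z| ≤
      δ * (2 * (∑ i ∈ Finset.range (k + 1), (k.choose i : ℝ) * ‖dirDeriv i φ a z‖) + 2 ^ k * δ) := by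
  have hδ0 : 0 ≤ δ := (norm_nonneg _).trans (hδ 0 (Nat.zero_le _))
  have hh : ContDiffOn ℝ k (fun z => φ z - φ' z) W := hφ.sub hφ'
  have h2φ : ContDiffOn ℝ k (fun z => (2 : ℝ) • φ z) W := hφ.const_smul (2 : ℝ)
  have hu : ContDiffOn ℝ k (fun z => (2 : ℝ) • φ z - (φ z - φ' z)) W := h2φ.sub hh
  have hat : ∀ {w : E → ℂ}, ContDiffOn ℝ k w W → ∀ {i : ℕ}, i ≤ k → ContDiffAt ℝ i w z :=
    fun hw i hi => (hw.contDiffAt (hW.mem_nhds hz)).of_le (by exact_mod_cast hi)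
  have key := norm_dirDeriv_bilinear_le (innerSL ℝ : ℂ →L[ℝ] ℂ →L[ℝ] ℝ)
    innerSL_complex_norm_le_one hW hu hh hz a
  have hsq : ∀ {w : E → ℂ}, ContDiffOn ℝ k w W → ContDiffAt ℝ k (fun z => ‖w z‖ ^ 2) z :=
    fun hw => ((hw.norm_sq ℝ).contDiffAt (hW.mem_nhds hz))
  rw [← dirDeriv_sub (hsq hφ) (hsq hφ')]
  -- With h = φ - φ', the difference of squares is ⟨2φ - h, h⟩, which involves only φ and h and not
  -- separate bounds for φ'.
  have heq : (fun z => ‖φ z‖ ^ 2 - ‖φ' z‖ ^ 2) =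
      fun z => (innerSL ℝ : ℂ →L[ℝ] ℂ →L[ℝ] ℝ) ((2 : ℝ) • φ z - (φ z - φ' z)) (φ z - φ' z) := by
    funext z
    rw [innerSL_apply_apply, show (2 : ℝ) • φ z - (φ z - φ' z) = φ z + φ' z by rw [two_smul]; abel,
      inner_add_left, inner_sub_right, inner_sub_right, real_inner_self_eq_norm_sq,
      real_inner_self_eq_norm_sq, real_inner_comm (φ z) (φ' z)]
    ring
  rw [heq, ← Real.norm_eq_abs]
  refine key.trans ?_
  calc _ ≤ ∑ i ∈ Finset.range (k + 1), (k.choose i : ℝ) * (2 * ‖dirDeriv i φ a z‖ + δ) * δ := by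
        refine Finset.sum_le_sum fun i hi => ?_
        have hik : i ≤ k := by rw [Finset.mem_range] at hi; omega
        gcongr
        · rw [dirDeriv_sub (hat h2φ hik) (hat hh hik), dirDeriv_const_smul _ (hat hφ hik)]
          refine (norm_sub_le _ _).trans (add_le_add ?_ (hδ i hik))
          rw [norm_smul]; norm_num
        · exact hδ _ (Nat.sub_le _ _)
    _ = _ := by
        have : ∑ i ∈ Finset.range (k + 1), (k.choose i : ℝ) = 2 ^ k := by
          exact_mod_cast Nat.sum_range_choose k
        rw [← this, Finset.sum_mul, Finset.mul_sum, ← Finset.sum_add_distrib, Finset.mul_sum]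
        refine Finset.sum_congr rfl fun i _ => ?_
        ring

theorem abs_dirDeriv_normSq_le {W : Set E} (hW : IsOpen W) {φ : E → ℂ} {k : ℕ}
    (hφ : ContDiffOn ℝ k φ W) {z : E} (hz : z ∈ W) (a : E) {C : ℝ}
    (hC : ∀ j ≤ k, ‖dirDeriv j φ a z‖ ≤ C) :
    |dirDeriv k (fun z => ‖φ z‖ ^ 2) a z| ≤ 2 ^ k * C ^ 2 := by
  have hC0 : 0 ≤ C := (norm_nonneg _).trans (hC 0 (Nat.zero_le _))
  have key := norm_dirDeriv_bilinear_le (innerSL ℝ : ℂ →L[ℝ] ℂ →L[ℝ] ℝ)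
    innerSL_complex_norm_le_one hW hφ hφ hz a
  have heq : (fun z => ‖φ z‖ ^ 2) = fun z => (innerSL ℝ : ℂ →L[ℝ] ℂ →L[ℝ] ℝ) (φ z) (φ z) := by
    funext z
    rw [innerSL_apply_apply, real_inner_self_eq_norm_sq]
  rw [heq, ← Real.norm_eq_abs]
  refine key.trans ?_
  calc _ ≤ ∑ i ∈ Finset.range (k + 1), (k.choose i : ℝ) * C * C := by
        refine Finset.sum_le_sum fun i hi => ?_
        have hik : i ≤ k := by rw [Finset.mem_range] at hi; omega
        gcongr
        · exact hC i hik
        · exact hC _ (Nat.sub_le _ _)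
    _ = _ := by
        rw [← Finset.sum_mul, ← Finset.sum_mul]
        have : ∑ i ∈ Finset.range (k + 1), (k.choose i : ℝ) = 2 ^ k := by
          exact_mod_cast Nat.sum_range_choose k
        rw [this]; ring

end Sections

/-! ### A direction with short sections, uniformly near a point. -/

section Direction

variable {E : Type*} [NormedAddCommGroup E] [NormedSpace ℝ E]

theorem eight_le_pow {μ : ℕ} (hμ : 0 < μ) : (8 : ℝ) ≤ (4 * (1 + 1 / (μ : ℝ))) ^ μ := by
  have hμ' : (0 : ℝ) < μ := by exact_mod_cast hμ
  have h1 : 1 + (μ : ℝ) * (1 / μ) ≤ (1 + 1 / (μ : ℝ)) ^ μ :=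
    one_add_mul_le_pow (by have : (0 : ℝ) ≤ 1 / μ := by positivity
                           linarith) _
  have h2 : (4 : ℝ) ^ 1 ≤ 4 ^ μ := pow_le_pow_right₀ (by norm_num) hμ
  rw [mul_one_div_cancel hμ'.ne'] at h1
  rw [mul_pow]
  nlinarith

/-- The spacing 8(1 + 1/μ)x is chosen so that μ of them make 8(μ+1)x. Since k < μ, a spare factor x
≤ 1/640 absorbs the constants. -/
theorem section_le_of_low_order {W : Set E} (hW : IsOpen W) {w : E → ℝ} {μ k : ℕ} (hμ : 0 < μ)
    (hk : k < μ) (hw : ContDiffOn ℝ k w W) {y : E} {r : ℝ} (hball : Metric.ball y r ⊆ W) {a : E}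
    (ha : ‖a‖ = 1) {β x : ℝ} (hβ : 0 < β) (hx : 0 < x) (hx' : x ≤ 1 / 640)
    (hc : ∀ z ∈ Metric.ball y r, 0.44 * β ≤ |dirDeriv k w a z|) (z : E) {A : Set ℝ}
    (hA : ∀ t ∈ A, z + t • a ∈ Metric.ball y r ∧ |w (z + t • a)| ≤ x ^ μ * β) :
    volume A ≤ ENNReal.ofReal (8 * (μ + 1) * x) := by
  have hμ' : (0 : ℝ) < μ := by exact_mod_cast hμ
  refine (volume_section_le hW hw hball ha hc (h := 8 * (1 + 1 / (μ : ℝ)) * x) (by positivity) ?_ z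
    hA).trans (ENNReal.ofReal_le_ofReal ?_)
  · have h1 : x ^ μ ≤ x ^ k * (1 / 640) := by
      rw [← Nat.add_sub_of_le hk.le, pow_add]
      gcongr
      refine (pow_le_of_le_one hx.le (by linarith) (by omega)).trans hx'
    have h2 : (2 * x) ^ k ≤ (8 * (1 + 1 / (μ : ℝ)) * x) ^ k := by
      gcongr
      have : (0 : ℝ) ≤ 1 / μ := by positivity
      linarith
    have h3 : 0 < (2 * x) ^ k := by positivity
    calc 2 ^ k * (x ^ μ * β) ≤ 2 ^ k * (x ^ k * (1 / 640) * β) := by gcongr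
      _ = (2 * x) ^ k * β * (1 / 640) := by rw [mul_pow]; ring
      _ < 0.44 * β * (2 * x) ^ k := by nlinarith [mul_pos h3 hβ]
      _ ≤ _ := by gcongr
  · have hk' : (k : ℝ) ≤ μ := by exact_mod_cast hk.le
    have h0 : 0 ≤ 8 * (1 + 1 / (μ : ℝ)) * x := by positivity
    calc (k : ℝ) * (8 * (1 + 1 / (μ : ℝ)) * x) ≤ μ * (8 * (1 + 1 / (μ : ℝ)) * x) := by gcongr
      _ = _ := by field_simp

/-- No power of x is spare here. With the same spacing, `eight_le_pow` suffices because 0.127 · 8 >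
1. -/
theorem section_le_of_top_order {W : Set E} (hW : IsOpen W) {w : E → ℝ} {μ : ℕ} (hμ : 0 < μ)
    (hw : ContDiffOn ℝ μ w W) {y : E} {r : ℝ} (hball : Metric.ball y r ⊆ W) {a : E}
    (ha : ‖a‖ = 1) {β x : ℝ} (hβ : 0 < β) (hx : 0 < x)
    (hc : ∀ z ∈ Metric.ball y r, 0.127 * β ≤ |dirDeriv μ w a z|) (z : E) {A : Set ℝ}
    (hA : ∀ t ∈ A, z + t • a ∈ Metric.ball y r ∧ |w (z + t • a)| ≤ x ^ μ * β) :
    volume A ≤ ENNReal.ofReal (8 * (μ + 1) * x) := by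
  have hμ' : (0 : ℝ) < μ := by exact_mod_cast hμ
  refine (volume_section_le hW hw hball ha hc (h := 8 * (1 + 1 / (μ : ℝ)) * x) (by positivity) ?_ z
    hA).trans (ENNReal.ofReal_le_ofReal (le_of_eq (by field_simp)))
  have h1 : (8 * (1 + 1 / (μ : ℝ)) * x) ^ μ = (2 * x) ^ μ * (4 * (1 + 1 / (μ : ℝ))) ^ μ := by
    rw [← mul_pow]; ring
  have h2 := eight_le_pow hμ
  have h3 : 0 < (2 * x) ^ μ * β := by positivity
  rw [h1, ← mul_assoc, ← mul_pow]
  nlinarith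

/-- Here the square of `w`, and not `w`, is at most x^μ β, so order j acts like order 2j. As 2j ≤ μ,
the spacing may be doubled without exceeding the total length 8(μ+1)x. -/
theorem section_le_of_half_order {W : Set E} (hW : IsOpen W) {w : E → ℝ} {μ j : ℕ} (hμ : 0 < μ)
    (hj : 2 * j ≤ μ) (hw : ContDiffOn ℝ j w W) {y : E} {r : ℝ} (hball : Metric.ball y r ⊆ W) {a : E}
    (ha : ‖a‖ = 1) {β x F : ℝ} (hβ : 0 < β) (hx : 0 < x) (hx' : x ≤ 1 / 640) (hF0 : 0 ≤ F)
    (hF : 0.9999 * β ≤ 2 ^ μ * F ^ 2)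
    (hc : ∀ z ∈ Metric.ball y r, 0.178 * F ≤ |dirDeriv j w a z|) (z : E) {A : Set ℝ}
    (hA : ∀ t ∈ A, z + t • a ∈ Metric.ball y r ∧ |w (z + t • a)| ^ 2 ≤ x ^ μ * β) :
    volume A ≤ ENNReal.ofReal (8 * (μ + 1) * x) := by
  have hμ' : (0 : ℝ) < μ := by exact_mod_cast hμ
  have hj' : 2 * (j : ℝ) ≤ μ := by exact_mod_cast hj
  refine (volume_section_le hW hw hball ha hc (h := 16 * (1 + 1 / (μ : ℝ)) * x)
    (ε := √(x ^ μ * β)) (by positivity) ?_ z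
    (fun t ht => ⟨(hA t ht).1, Real.le_sqrt_of_sq_le (hA t ht).2⟩)).trans
      (ENNReal.ofReal_le_ofReal ?_)
  · set H := 16 * (1 + 1 / (μ : ℝ)) * x with hH
    have hsq : (2 ^ j * √(x ^ μ * β)) ^ 2 < (0.178 * F * H ^ j) ^ 2 := by
      rw [mul_pow, Real.sq_sqrt (by positivity)]
      have hF2 : 0.9999 * β / 2 ^ μ ≤ F ^ 2 := by
        rw [div_le_iff₀ (by positivity)]; linarith
      have hlow : 0.031684 * (0.9999 * β / 2 ^ μ) * (H ^ j) ^ 2 ≤ (0.178 * F * H ^ j) ^ 2 := by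
        have : (0.178 * F * H ^ j) ^ 2 = 0.031684 * F ^ 2 * (H ^ j) ^ 2 := by ring
        rw [this]
        gcongr
      refine lt_of_lt_of_le ?_ hlow
      suffices h : (2 ^ j) ^ 2 * (2 * x) ^ μ < 0.03168 * (H ^ j) ^ 2 by
        have h2 : (0 : ℝ) < β / 2 ^ μ := by positivity
        calc (2 ^ j) ^ 2 * (x ^ μ * β) = (2 ^ j) ^ 2 * (2 * x) ^ μ * (β / 2 ^ μ) := by
              rw [mul_pow]; field_simp
          _ < 0.03168 * (H ^ j) ^ 2 * (β / 2 ^ μ) := by gcongr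
          _ ≤ 0.031684 * (0.9999 * β / 2 ^ μ) * (H ^ j) ^ 2 := by
              have : 0.031684 * (0.9999 * β / 2 ^ μ) * (H ^ j) ^ 2 =
                (0.031684 * 0.9999) * (H ^ j) ^ 2 * (β / 2 ^ μ) := by ring
              rw [this]; gcongr; norm_num
      have hHj : (H ^ j) ^ 2 = (2 ^ j) ^ 2 * (2 * x) ^ (2 * j) * ((4 * (1 + 1 / (μ : ℝ))) ^ j) ^ 2 := by
        have : H = 2 * (2 * x) * (4 * (1 + 1 / (μ : ℝ))) := by rw [hH]; ring
        rw [this, mul_pow, mul_pow, mul_pow, mul_pow, ← pow_mul (2 * x), mul_comm j 2]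
      have h4 : (4 : ℝ) ^ j ≤ (4 * (1 + 1 / (μ : ℝ))) ^ j := by
        gcongr
        have : (0 : ℝ) ≤ 1 / μ := by positivity
        linarith
      have hpos : 0 < ((2 : ℝ) ^ j) ^ 2 * (2 * x) ^ (2 * j) := by positivity
      -- If 2j = μ no power of x is spare, and 6² · 0.03168 > 1 is used; the bound 6 is attained at
      -- j = 1, μ = 2. Otherwise a factor 2x ≤ 1/320 is available.
      rcases hj.eq_or_lt with heq | hlt
      · have hj1 : 0 < j := by omega
        have h6 : (6 : ℝ) ≤ (4 * (1 + 1 / (μ : ℝ))) ^ j := by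
          rcases Nat.lt_or_ge 1 j with h | h
          · have : (4 : ℝ) ^ 2 ≤ 4 ^ j := pow_le_pow_right₀ (by norm_num) h
            linarith
          · have hj2 : j = 1 := by omega
            subst hj2
            have : (μ : ℝ) = 2 := by rw [← heq]; norm_num
            rw [this]; norm_num
        have hpw : (2 * x) ^ μ = (2 * x) ^ (2 * j) := by rw [heq]
        rw [hHj, hpw]
        nlinarith [mul_le_mul h6 h6 (by norm_num) (by positivity)]
      · have h5 : (2 * x) ^ μ ≤ (2 * x) ^ (2 * j) * (1 / 320) := by
          rw [← Nat.add_sub_of_le hlt.le, pow_add]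
          gcongr
          refine (pow_le_of_le_one (by positivity) (by linarith) (by omega)).trans (by linarith)
        have h1 : (1 : ℝ) ≤ (4 * (1 + 1 / (μ : ℝ))) ^ j :=
          (one_le_pow₀ (by norm_num : (1 : ℝ) ≤ 4)).trans h4
        rw [hHj]
        calc (2 ^ j) ^ 2 * (2 * x) ^ μ ≤ (2 ^ j) ^ 2 * ((2 * x) ^ (2 * j) * (1 / 320)) := by gcongr
          _ < _ := by nlinarith [mul_le_mul h1 h1 (by norm_num) (by positivity)]
    exact lt_of_pow_lt_pow_left₀ 2 (by positivity) hsq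
  · calc (j : ℝ) * (16 * (1 + 1 / (μ : ℝ)) * x) = 2 * j * (8 * (1 + 1 / (μ : ℝ)) * x) := by ring
      _ ≤ μ * (8 * (1 + 1 / (μ : ℝ)) * x) := by gcongr
      _ = _ := by field_simp

/-- If `φ'` is `C^μ`-close to `φ` and some derivative of `|φ|²` of order at most `μ` at `y` is at
least about `β`, then near `y` the set where `|φ'|² ≤ x ^ μ * β` has short sections in some
direction. -/
theorem exists_direction_section_le {W : Set E} (hW : IsOpen W) {φ φ' : E → ℂ} {μ : ℕ} (hμ : 0 < μ)
    (hφ : ∀ z ∈ W, ContDiffAt ℝ (⊤ : ℕ∞) φ z) (hφ' : ContDiffOn ℝ μ φ' W) {β F δ G r : ℝ} (hβ : 0 < β)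
    (hF : ∀ z ∈ W, ∀ j ≤ μ, ∀ a : E, ‖a‖ = 1 → ‖dirDeriv j φ a z‖ ≤ F)
    (hδ : ∀ z ∈ W, ∀ j ≤ μ, ∀ a : E, ‖a‖ = 1 → ‖dirDeriv j (fun z => φ z - φ' z) a z‖ ≤ δ)
    (hG : ∀ z ∈ W, ∀ j ≤ μ + 1, ∀ a : E, ‖a‖ = 1 → |dirDeriv j (fun z => ‖φ z‖ ^ 2) a z| ≤ G)
    (hδF : δ * (F + δ) ≤ β / 2 ^ (μ + 1)) (hβG : β ≤ G) {y : E} (hball : Metric.ball y r ⊆ W)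
    (hr : 0 < r) (hrG : r * (polarConst (μ + 1) * G) ≤ β / 20)
    (hy : ∃ k ≤ μ, ∃ a : E, ‖a‖ = 1 ∧ 0.9999 * β ≤ |dirDeriv k (fun z => ‖φ z‖ ^ 2) a y|)
    {x : ℝ} (hx : 0 < x) (hxr : 8 * (μ + 1) * x < r) :
    ∃ a : E, ‖a‖ = 1 ∧ ∀ (z : E) (A : Set ℝ),
      (∀ t ∈ A, z + t • a ∈ Metric.ball y r ∧ ‖φ' (z + t • a)‖ ^ 2 ≤ x ^ μ * β) →
      volume A ≤ ENNReal.ofReal (8 * (μ + 1) * x) := by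
  obtain ⟨k, hk, a, ha, hka⟩ := hy
  have hyW : y ∈ W := hball (Metric.mem_ball_self hr)
  have hμ1 : (1 : ℝ) ≤ μ := by exact_mod_cast hμ
  have hF0 : 0 ≤ F := (norm_nonneg _).trans (hF y hyW 0 (Nat.zero_le _) a ha)
  have hδ0 : 0 ≤ δ := (norm_nonneg _).trans (hδ y hyW 0 (Nat.zero_le _) a ha)
  have hG0 : 0 < G := hβ.trans_le hβG
  have hP2 : (2 : ℝ) ≤ polarConst (μ + 1) :=
    le_trans (by simpa using pow_le_pow_right₀ (by norm_num : (1 : ℝ) ≤ 2) hμ)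
      (two_pow_le_polarConst μ)
  have hrP : r * polarConst (μ + 1) ≤ 1 / 20 := by
    have : r * polarConst (μ + 1) * G ≤ 1 / 20 * G := by linarith
    exact le_of_mul_le_mul_right this hG0
  -- From r · 2 ≤ 1/20 and 16x ≤ 8(μ+1)x < r.
  have hx' : x ≤ 1 / 640 := by nlinarith
  have hφc : ∀ m : ℕ, ContDiffOn ℝ m φ W := fun m z hz =>
    ((hφ z hz).of_le (by exact_mod_cast le_top)).contDiffWithinAt
  have hg : ∀ z ∈ W, ContDiffAt ℝ (⊤ : ℕ∞) (fun z => ‖φ z‖ ^ 2) z := fun z hz => (hφ z hz).norm_sq ℝ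
  have hg' : ContDiffOn ℝ μ (fun z => ‖φ' z‖ ^ 2) W := hφ'.norm_sq ℝ
  have hkF : 0.9999 * β ≤ 2 ^ μ * F ^ 2 := by
    refine hka.trans ((abs_dirDeriv_normSq_le hW (hφc k) hyW a
      (fun j hj => hF y hyW j (hj.trans hk) a ha)).trans ?_)
    gcongr
    norm_num
  have hmove : ∀ z ∈ Metric.ball y r,
      |dirDeriv k (fun z => ‖φ z‖ ^ 2) a z - dirDeriv k (fun z => ‖φ z‖ ^ 2) a y| ≤ β / 20 := by
    intro z hz
    have := norm_dirDeriv_sub_le (fun z hz => (hg z (hball hz)).of_le (by exact_mod_cast le_top (α := ℕ∞))) hG0.le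
      (fun z hz b hb => hG z (hball hz) (k + 1) (by omega) b hb) hz ha
    rw [Real.norm_eq_abs] at this
    refine this.trans (le_trans ?_ hrG)
    have h1 : polarConst (k + 1) ≤ polarConst (μ + 1) := monotone_polarConst (by omega)
    calc polarConst (k + 1) * G * r ≤ polarConst (μ + 1) * G * r := by gcongr
      _ = _ := by ring
  have hδF' : 2 ^ μ * (δ * (F + δ)) ≤ β / 2 := by
    rw [pow_succ, le_div_iff₀ (by positivity)] at hδF
    linarith
  -- 0.9499 is 0.9999 minus the variation 1/20 over the ball; the term subtracted is the cost of
  -- replacing φ by φ'.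
  have hlow : ∀ z ∈ Metric.ball y r, ∀ S : ℝ,
      ∑ i ∈ Finset.range (k + 1), (k.choose i : ℝ) * ‖dirDeriv i φ a z‖ ≤ S →
      0.9499 * β - δ * (2 * S + 2 ^ k * δ) ≤ |dirDeriv k (fun z => ‖φ' z‖ ^ 2) a z| := by
    intro z hz S hS
    have h1 := abs_dirDeriv_normSq_sub_le hW (hφc k) (hφ'.of_le (by exact_mod_cast hk)) (hball hz) a
      (fun j hj => hδ z (hball hz) j (hj.trans hk) a ha)
    have h2 : δ * (2 * (∑ i ∈ Finset.range (k + 1), (k.choose i : ℝ) * ‖dirDeriv i φ a z‖) +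
        2 ^ k * δ) ≤ δ * (2 * S + 2 ^ k * δ) := by gcongr
    have h3 := hmove z hz
    have h4 := abs_sub_abs_le_abs_sub (dirDeriv k (fun z => ‖φ z‖ ^ 2) a y)
      (dirDeriv k (fun z => ‖φ z‖ ^ 2) a z)
    have h5 := abs_sub_abs_le_abs_sub (dirDeriv k (fun z => ‖φ z‖ ^ 2) a z)
      (dirDeriv k (fun z => ‖φ' z‖ ^ 2) a z)
    rw [abs_sub_comm] at h3
    linarith
  have habs : ∀ z, |‖φ' z‖ ^ 2| = ‖φ' z‖ ^ 2 := fun z => abs_of_nonneg (by positivity)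
  -- Below top order, 2^(k+1) ≤ 2^μ keeps the cost of replacing φ by at most β/2, leaving more than
  -- 0.44 β.
  rcases hk.lt_or_eq with hkμ | rfl
  · refine ⟨a, ha, fun z A hA => section_le_of_low_order hW hμ hkμ
      (hg'.of_le (by exact_mod_cast hk)) hball ha hβ hx hx' ?_ z
      (fun t ht => ⟨(hA t ht).1, by rw [habs]; exact (hA t ht).2⟩)⟩
    intro z hz
    have hS : ∑ i ∈ Finset.range (k + 1), (k.choose i : ℝ) * ‖dirDeriv i φ a z‖ ≤ 2 ^ k * F := by
      have : ∑ i ∈ Finset.range (k + 1), (k.choose i : ℝ) = 2 ^ k := by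
        exact_mod_cast Nat.sum_range_choose k
      rw [← this, Finset.sum_mul]
      refine Finset.sum_le_sum fun i hi => ?_
      rw [Finset.mem_range] at hi
      exact mul_le_mul_of_nonneg_left (hF z (hball hz) i (by omega) a ha) (Nat.cast_nonneg _)
    have h1 := hlow z hz _ hS
    have h2 : (2 : ℝ) ^ (k + 1) ≤ 2 ^ μ := pow_le_pow_right₀ (by norm_num) hkμ
    have h3 : δ * (2 * (2 ^ k * F) + 2 ^ k * δ) ≤ 2 ^ μ * (δ * (F + δ)) := by
      calc δ * (2 * (2 ^ k * F) + 2 ^ k * δ) ≤ 2 ^ (k + 1) * (δ * (F + δ)) := by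
            rw [pow_succ]
            have : 0 ≤ 2 ^ k * (δ * δ) := by positivity
            nlinarith
        _ ≤ _ := by gcongr
    linarith
  · have hmoveφ : ∀ j, 2 * j ≤ k → ∀ z ∈ Metric.ball y r,
        ‖dirDeriv j φ a z - dirDeriv j φ a y‖ ≤ 0.05 * F := by
      intro j hj z hz
      have := norm_dirDeriv_sub_le (fun z hz => (hφ z (hball hz)).of_le (by exact_mod_cast le_top (α := ℕ∞))) hF0
        (fun z hz b hb => hF z (hball hz) (j + 1) (by omega) b hb) hz ha
      refine this.trans ?_
      have h1 : polarConst (j + 1) ≤ polarConst (k + 1) := monotone_polarConst (by omega)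
      calc polarConst (j + 1) * F * r ≤ polarConst (k + 1) * F * r := by gcongr
        _ = r * polarConst (k + 1) * F := by ring
        _ ≤ 1 / 20 * F := by gcongr
        _ = _ := by ring
    -- At top order the crude cost can reach β, whence the dichotomy on the derivatives of φ along a
    -- of order at most k/2.
    by_cases hbig : ∃ j, 2 * j ≤ k ∧ 0.595 * F < ‖dirDeriv j φ a y‖
    · obtain ⟨j, hj, hjF⟩ := hbig
      have hFpos : 0 < F := by
        rcases hF0.eq_or_lt with h | h
        · rw [← h] at hkF; norm_num at hkF; linarith
        · exact h
      -- Otherwise δ(F+δ) ≥ 0.501 F², and 2^k F² ≥ 0.9999 β contradicts 2^k δ(F+δ) ≤ β/2.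
      have hδ' : δ ≤ 0.367 * F := by
        by_contra hcon
        rw [not_le] at hcon
        have h1 : 0.501 * F ^ 2 ≤ δ * (F + δ) := by nlinarith
        have h2 : (2 : ℝ) ^ k * (0.501 * F ^ 2) ≤ 2 ^ k * (δ * (F + δ)) := by gcongr
        have h3 : (0 : ℝ) < 2 ^ k * F ^ 2 := by positivity
        nlinarith
      set ξ := dirDeriv j φ a y with hξ
      have hξ0 : 0 < ‖ξ‖ := by nlinarith
      -- The one-variable estimate needs a real function, so φ' is projected orthogonally onto the
      -- line of ξ. Its j-th derivative is at least (0.595 - 0.05 - 0.367) F = 0.178 F on the ball.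
      set L : ℂ →L[ℝ] ℝ := ‖ξ‖⁻¹ • (innerSL ℝ : ℂ →L[ℝ] ℂ →L[ℝ] ℝ) ξ with hL
      have hLapp : ∀ v, L v = ‖ξ‖⁻¹ * inner ℝ ξ v := fun v => rfl
      have hLξ : L ξ = ‖ξ‖ := by
        rw [hLapp, real_inner_self_eq_norm_sq, sq, inv_mul_cancel_left₀ hξ0.ne']
      have hLle : ∀ v, |L v| ≤ ‖v‖ := by
        intro v
        rw [hLapp, abs_mul, abs_of_pos (inv_pos.2 hξ0), inv_mul_le_iff₀ hξ0]
        exact abs_real_inner_le_norm ξ v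
      have hjk : j ≤ k := by omega
      have hφ'j : ContDiffOn ℝ j φ' W := hφ'.of_le (by exact_mod_cast hjk)
      refine ⟨a, ha, fun z A hA => section_le_of_half_order (w := fun z => L (φ' z)) hW hμ hj
        (L.contDiff.comp_contDiffOn hφ'j) hball ha hβ hx hx' hF0 hkF ?_ z
        (fun t ht => ⟨(hA t ht).1, ?_⟩)⟩
      · intro z hz
        have hz' := hball hz
        have hc1 := hφ'j.contDiffAt (hW.mem_nhds hz')
        have hc2 := (hφc j).contDiffAt (hW.mem_nhds hz')
        rw [dirDeriv_clm_comp L hc1]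
        have h1 := hδ z hz' j hjk a ha
        rw [dirDeriv_sub hc2 hc1] at h1
        have h2 := (hLle _).trans h1
        have h3 := (hLle _).trans (hmoveφ j hj z hz)
        rw [map_sub] at h2 h3
        rw [← hξ, hLξ] at h3
        have h4 := (abs_le.1 h2).2
        have h5 := (abs_le.1 h3).1
        refine le_trans ?_ (le_abs_self _)
        linarith
      · refine le_trans ?_ (hA t ht).2
        gcongr
        exact hLle _
    · push Not at hbig
      refine ⟨a, ha, fun z A hA => section_le_of_top_order hW hμ hg' hball ha hβ hx ?_ z
        (fun t ht => ⟨(hA t ht).1, by rw [habs]; exact (hA t ht).2⟩)⟩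
      intro z hz
      -- Low orders are at most (0.595 + 0.05) F on the ball, so the cost drops to 1.645 · β/2 =
      -- 0.8225 β, and 0.9499 - 0.8225 > 0.127.
      have hS := sum_choose_mul_le (μ := k) (w := fun i => ‖dirDeriv i φ a z‖) (A := 0.645 * F)
        (B := F) (fun i hi => by
          have h1 := norm_sub_norm_le (dirDeriv i φ a z) (dirDeriv i φ a y)
          have h2 := hmoveφ i hi z hz
          have h3 := hbig i hi
          linarith) (fun i hi => hF z (hball hz) i hi a ha)
      have h1 := hlow z hz _ hS
      have h2 : δ * (2 * (2 ^ k * ((0.645 * F + F) / 2)) + 2 ^ k * δ) ≤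
          1.645 * (2 ^ k * (δ * (F + δ))) := by
        have : 0 ≤ 2 ^ k * (δ * δ) := by positivity
        nlinarith
      linarith

end Direction

/-! ### From short sections to small volume. -/

section Volume

variable {V : Type*} [NormedAddCommGroup V] [InnerProductSpace ℝ V] [FiniteDimensional ℝ V]
  [MeasurableSpace V] [BorelSpace V]

/-- A set in a ball whose sections in a direction are short has small volume. -/
theorem volume_le_of_short_sections {m : ℕ} (hm : Module.finrank ℝ V = m + 1) {a : V} (ha : ‖a‖ = 1)
    {A : Set V} (hA : MeasurableSet A) {x₀ : V} {ρ : ℝ} (hAb : A ⊆ Metric.ball x₀ ρ) {L : ℝ≥0∞}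
    (hL : ∀ z : V, volume {t : ℝ | z + t • a ∈ A} ≤ L) :
    volume A ≤ L * volume (Metric.ball (0 : EuclideanSpace ℝ (Fin m)) ρ) := by
  obtain ⟨b, hb⟩ := Orthonormal.exists_orthonormalBasis_extension_of_card_eq (𝕜 := ℝ) (E := V)
    (ι := Fin (m + 1)) (by simpa using hm) (v := fun _ => a) (s := {0}) (by
      rw [orthonormal_iff_ite]
      rintro ⟨i, hi⟩ ⟨j, hj⟩
      have hi' : i = 0 := hi
      have hj' : j = 0 := hj
      subst hi' hj'
      simp [ha])
  have hb0 : b 0 = a := hb 0 rfl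
  set Ψ : ℝ × (Fin m → ℝ) → V := fun p => b.repr.symm (WithLp.toLp 2
    ((MeasurableEquiv.piFinSuccAbove (fun _ : Fin (m + 1) => ℝ) 0).symm p)) with hΨ
  have hΨmp : MeasurePreserving Ψ volume volume :=
    b.measurePreserving_repr_symm.comp ((PiLp.volume_preserving_toLp (Fin (m + 1))).comp
      ((volume_preserving_piFinSuccAbove (fun _ : Fin (m + 1) => ℝ) 0).symm))
  have hrepr0 : ∀ t z, b.repr (Ψ (t, z)) 0 = t := by
    intro t z
    simp [hΨ, MeasurableEquiv.piFinSuccAbove]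
  have hreprS : ∀ t z i, b.repr (Ψ (t, z)) (Fin.succ i) = z i := by
    intro t z i
    simp [hΨ, MeasurableEquiv.piFinSuccAbove]
  have hΨadd : ∀ t z, Ψ (t, z) = Ψ (0, z) + t • a := by
    intro t z
    apply b.repr.injective
    ext i
    refine Fin.cases ?_ (fun i => ?_) i
    · simp [hrepr0, ← hb0]
    · simp [hreprS, ← hb0, b.repr_self]
  set z₀ : EuclideanSpace ℝ (Fin m) := WithLp.toLp 2 (fun i => b.repr x₀ (Fin.succ i)) with hz₀
  -- Dropping the coordinate along a does not increase distances, so the base of the fibration lies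
  -- in a ball of radius ρ.
  have hball : ∀ t z, Ψ (t, z) ∈ A → WithLp.toLp 2 z ∈ Metric.ball z₀ ρ := by
    intro t z h
    have h1 := Metric.mem_ball.1 (hAb h)
    refine Metric.mem_ball.2 (lt_of_le_of_lt ?_ h1)
    rw [← b.repr.dist_map, EuclideanSpace.dist_eq, EuclideanSpace.dist_eq]
    refine Real.sqrt_le_sqrt ?_
    rw [Fin.sum_univ_succ (f := fun i => dist (b.repr (Ψ (t, z)) i) (b.repr x₀ i) ^ 2)]
    simp_rw [hreprS]
    simp [hz₀]
  have hB : MeasurableSet (WithLp.toLp 2 ⁻¹' Metric.ball z₀ ρ : Set (Fin m → ℝ)) :=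
    (PiLp.volume_preserving_toLp (Fin m)).measurable measurableSet_ball
  rw [← hΨmp.measure_preimage hA.nullMeasurableSet, Measure.volume_eq_prod,
    Measure.prod_apply_symm (hΨmp.measurable hA)]
  calc ∫⁻ z, volume ((fun t => (t, z)) ⁻¹' (Ψ ⁻¹' A))
      ≤ ∫⁻ z, (WithLp.toLp 2 ⁻¹' Metric.ball z₀ ρ : Set (Fin m → ℝ)).indicator (fun _ => L) z := by
        refine lintegral_mono fun z => ?_
        by_cases hz : z ∈ (WithLp.toLp 2 ⁻¹' Metric.ball z₀ ρ : Set (Fin m → ℝ))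
        · rw [Set.indicator_of_mem hz]
          refine le_trans (le_of_eq ?_) (hL (Ψ (0, z)))
          congr 1
          ext t
          change Ψ (t, z) ∈ A ↔ Ψ (0, z) + t • a ∈ A
          rw [hΨadd]
        · rw [Set.indicator_of_notMem hz]
          have : (fun t => (t, z)) ⁻¹' (Ψ ⁻¹' A) = ∅ := by
            ext t
            simp only [Set.mem_preimage, Set.mem_empty_iff_false, iff_false]
            exact fun h => hz (hball t z h)
          rw [this, measure_empty]
    _ = L * volume (Metric.ball (0 : EuclideanSpace ℝ (Fin m)) ρ) := by
        rw [lintegral_indicator_const hB,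
          (PiLp.volume_preserving_toLp (Fin m)).measure_preimage measurableSet_ball.nullMeasurableSet,
          Measure.addHaar_ball_center]

/-- The ratio of the unit ball volumes is nΓ(n)/(√π Γ(n+1/2)), at most n since Γ increases on [2, ∞)
and π ≥ 1. -/
theorem volume_ball_codim_one_le {n : ℕ} (hn : 2 ≤ n) (hV : Module.finrank ℝ V = 2 * n) {ρ : ℝ}
    (hρ : 0 < ρ) : volume (Metric.ball (0 : EuclideanSpace ℝ (Fin (2 * n - 1))) ρ) ≤
      ENNReal.ofReal (n / ρ) * volume (Metric.ball (0 : V) ρ) := by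
  have hn' : (2 : ℝ) ≤ n := by exact_mod_cast hn
  have : Nonempty (Fin (2 * n - 1)) := ⟨⟨0, by omega⟩⟩
  have : Nontrivial V := Module.nontrivial_of_finrank_pos (R := ℝ) (by omega)
  rw [EuclideanSpace.volume_ball, InnerProductSpace.volume_ball, hV, Fintype.card_fin,
    ← ENNReal.ofReal_pow hρ.le, ← ENNReal.ofReal_pow hρ.le, ← ENNReal.ofReal_mul (by positivity),
    ← ENNReal.ofReal_mul (by positivity), ← ENNReal.ofReal_mul (by positivity)]
  refine ENNReal.ofReal_le_ofReal ?_
  have hcast : ((2 * n - 1 : ℕ) : ℝ) / 2 + 1 = n + 1 / 2 := by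
    rw [Nat.cast_sub (by omega)]; push_cast; ring
  have hcast2 : ((2 * n : ℕ) : ℝ) / 2 + 1 = n + 1 := by push_cast; ring
  rw [hcast, hcast2, Real.Gamma_add_one (by positivity)]
  have hG : Real.Gamma n ≤ Real.Gamma (n + 1 / 2) :=
    Real.Gamma_strictMonoOn_Ici.monotoneOn (by simpa using hn')
      (by simp only [Set.mem_Ici]; linarith) (by linarith)
  have hG0 : 0 < Real.Gamma n := Real.Gamma_pos_of_pos (by linarith)
  have hpi : 1 ≤ √Real.pi := Real.one_le_sqrt.2 (by linarith [Real.pi_gt_three])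
  obtain ⟨k, hk⟩ : ∃ k, 2 * n = k + 1 := ⟨2 * n - 1, by omega⟩
  rw [show 2 * n - 1 = k by omega, hk]
  calc ρ ^ k * (√Real.pi ^ k / Real.Gamma (n + 1 / 2))
      ≤ ρ ^ k * (√Real.pi ^ (k + 1) / Real.Gamma n) := by
        gcongr
        omega
    _ = _ := by
        field_simp
        ring

/-- In orthonormal coordinates the sup norm is at most the Euclidean one, so this is the bound by
the volume of a cube. -/
theorem volume_le_diam_pow {s : Set V} (hs : Bornology.IsBounded s) :
    volume s ≤ ENNReal.ofReal (Metric.diam s ^ Module.finrank ℝ V) := by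
  set b := stdOrthonormalBasis ℝ V
  have hmp : MeasurePreserving (fun v => WithLp.ofLp (b.repr v)) volume volume :=
    (PiLp.volume_preserving_ofLp _).comp b.measurePreserving_repr
  set T : Set (Fin (Module.finrank ℝ V) → ℝ) := (fun v => WithLp.ofLp (b.repr v)) '' s
  have hlip : LipschitzWith 1 (fun v : V => WithLp.ofLp (b.repr v)) := by
    have h1 : LipschitzWith 1 (fun v : V => b.repr v) := b.repr.lipschitz
    have h2 := PiLp.lipschitzWith_ofLp 2 (fun _ : Fin (Module.finrank ℝ V) => ℝ)
    exact (h2.comp h1).weaken (by simp)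
  have hT : Metric.ediam T ≤ ENNReal.ofReal (Metric.diam s) := by
    have := hlip.ediam_image_le s
    rw [ENNReal.coe_one, one_mul] at this
    rwa [Metric.diam, ENNReal.ofReal_toReal hs.ediam_ne_top]
  calc volume s ≤ volume ((fun v => WithLp.ofLp (b.repr v)) ⁻¹' (closure T)) :=
        measure_mono fun v hv => subset_closure ⟨v, hv, rfl⟩
    _ = volume (closure T) := hmp.measure_preimage isClosed_closure.measurableSet.nullMeasurableSet
    _ ≤ Metric.ediam (closure T) ^ Module.finrank ℝ V := by
        simpa using Real.volume_pi_le_diam_pow (closure T)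
    _ ≤ ENNReal.ofReal (Metric.diam s) ^ Module.finrank ℝ V := by
        rw [Metric.ediam_closure]
        gcongr
    _ = _ := (ENNReal.ofReal_pow Metric.diam_nonneg _).symm

theorem lintegral_volume_inter_ball {A : Set V} (hA : MeasurableSet A) (ρ : ℝ) :
    ∫⁻ x : V, volume (A ∩ Metric.ball x ρ) = volume A * volume (Metric.ball (0 : V) ρ) := by
  set S : Set (V × V) := {p | p.2 ∈ A ∧ dist p.2 p.1 < ρ} with hS
  have hSm : MeasurableSet S :=
    (measurable_snd hA).inter (isOpen_lt (continuous_snd.dist continuous_fst) continuous_const).measurableSet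
  have h1 : ∀ x, A ∩ Metric.ball x ρ = Prod.mk x ⁻¹' S := fun x => rfl
  simp_rw [h1]
  rw [← Measure.prod_apply hSm, Measure.prod_apply_symm hSm]
  have h2 : ∀ y, volume ((fun x => (x, y)) ⁻¹' S) =
      A.indicator (fun _ => volume (Metric.ball (0 : V) ρ)) y := by
    intro y
    by_cases hy : y ∈ A
    · rw [Set.indicator_of_mem hy, ← Measure.addHaar_ball_center volume y]
      congr 1
      ext x
      simp [hS, hy, dist_comm]
    · rw [Set.indicator_of_notMem hy]
      have : (fun x => (x, y)) ⁻¹' S = ∅ := by ext x; simp [hS, hy]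
      rw [this, measure_empty]
  simp_rw [h2]
  rw [lintegral_indicator_const hA, mul_comm]

/-- A set whose intersections with all balls of radius `ρ` have short sections in some direction
has small volume. -/
theorem volume_le_of_local_sections {n : ℕ} (hn : 2 ≤ n) (hV : Module.finrank ℝ V = 2 * n)
    {A K : Set V} (hA : MeasurableSet A) (hAK : A ⊆ K) (hK : Bornology.IsBounded K) {ρ L : ℝ}
    (hρ : 0 < ρ)
    (hL : ∀ x₀ : V, (A ∩ Metric.ball x₀ ρ).Nonempty → ∃ a : V, ‖a‖ = 1 ∧
      ∀ z : V, volume {t : ℝ | z + t • a ∈ A ∩ Metric.ball x₀ ρ} ≤ ENNReal.ofReal L) :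
    volume A ≤ ENNReal.ofReal ((Metric.diam K + 2 * ρ) ^ (2 * n) * (n / ρ) * L) := by
  set B := volume (Metric.ball (0 : V) ρ) with hB
  have hB0 : B ≠ 0 := (Metric.measure_ball_pos volume 0 hρ).ne'
  have hBt : B ≠ ⊤ := measure_ball_lt_top.ne
  -- Averaging over all centres x replaces a covering by balls; only centres within ρ of `K`
  -- contribute.
  have hpt : ∀ x, volume (A ∩ Metric.ball x ρ) ≤ (Metric.thickening ρ K).indicator
      (fun _ => ENNReal.ofReal L * (ENNReal.ofReal (n / ρ) * B)) x := by
    intro x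
    rcases (A ∩ Metric.ball x ρ).eq_empty_or_nonempty with h | h
    · rw [h, measure_empty]; exact zero_le
    · have hx : x ∈ Metric.thickening ρ K := by
        obtain ⟨y, hy, hyx⟩ := h
        exact Metric.mem_thickening_iff.2 ⟨y, hAK hy, by rwa [dist_comm]⟩
      rw [Set.indicator_of_mem hx]
      obtain ⟨a, ha, hsec⟩ := hL x h
      refine (volume_le_of_short_sections (m := 2 * n - 1) (by omega) ha
        (hA.inter measurableSet_ball) Set.inter_subset_right hsec).trans ?_
      gcongr
      exact volume_ball_codim_one_le hn hV hρ
  have h1 : volume A * B ≤ (ENNReal.ofReal L * (ENNReal.ofReal (n / ρ) * B)) *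
      volume (Metric.thickening ρ K) := by
    rw [← lintegral_volume_inter_ball hA, ← lintegral_indicator_const Metric.isOpen_thickening.measurableSet]
    exact lintegral_mono hpt
  have h2 : volume (Metric.thickening ρ K) ≤ ENNReal.ofReal ((Metric.diam K + 2 * ρ) ^ (2 * n)) := by
    refine (volume_le_diam_pow hK.thickening).trans (ENNReal.ofReal_le_ofReal ?_)
    rw [hV]
    exact pow_le_pow_left₀ Metric.diam_nonneg (Metric.diam_thickening_le _ hρ.le) _
  have h3 : volume A * B ≤ ENNReal.ofReal ((Metric.diam K + 2 * ρ) ^ (2 * n) * (n / ρ) * L) * B := by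
    refine h1.trans ((mul_le_mul_right h2 _).trans (le_of_eq ?_))
    have : 0 ≤ Metric.diam K := Metric.diam_nonneg
    rw [ENNReal.ofReal_mul (by positivity), ENNReal.ofReal_mul (by positivity)]
    ring
  exact (ENNReal.mul_le_mul_iff_left hB0 hBt).1 h3

end Volume

/-! ### The sublevel estimate with explicit constants. -/

section MeasureEstimate

theorem sq_mul_pow_le_seventeen_pow {n : ℕ} (hn : 2 ≤ n) :
    80 * (n : ℝ) ^ 2 * (25 / 16) ^ n ≤ 3 * 17 ^ n := by
  induction n, hn using Nat.le_induction with
  | base => norm_num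
  | succ n hn ih =>
    have hn' : (2 : ℝ) ≤ n := by exact_mod_cast hn
    have h1 : ((n + 1 : ℕ) : ℝ) ^ 2 ≤ 4 * (n : ℝ) ^ 2 := by push_cast; nlinarith
    calc 80 * ((n + 1 : ℕ) : ℝ) ^ 2 * (25 / 16) ^ (n + 1)
        ≤ 80 * (4 * (n : ℝ) ^ 2) * (25 / 16) ^ (n + 1) := by gcongr
      _ = 80 * (n : ℝ) ^ 2 * (25 / 16) ^ n * (25 / 4) := by ring
      _ ≤ 3 * 17 ^ n * 17 := by gcongr; norm_num
      _ = _ := by ring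

theorem sq_mul_pow_le_two_pi_e {n : ℕ} (hn : 2 ≤ n) :
    80 * (n : ℝ) ^ 2 * (25 / 16) ^ n ≤ 3 * (2 * Real.pi * Real.exp 1) ^ n := by
  refine (sq_mul_pow_le_seventeen_pow hn).trans ?_
  gcongr
  nlinarith [Real.pi_gt_d2, Real.exp_one_gt_d9]

/-- The radius is a minimum of three quantities, and each case is paid for by one term of the last
factor: d/4 by 1/√(2n), ϑ by d/ϑ, and 1/(20PQ) by 2d. The factor (25/16)^n comes from enlarging the
diameter d to at most 5d/4 in dimension 2n. -/
theorem diam_div_radius_le {n : ℕ} (hn : 2 ≤ n) {d ϑ Q P : ℝ} (hd : 0 < d) (hϑ : 0 < ϑ) (hP : 2 ≤ P)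
    (hQ : 1 ≤ Q) {r : ℝ} (hr : r = min (d / 4) (min ϑ (1 / (20 * P * Q)))) :
    16 * (n : ℝ) * (25 / 16) ^ n * (d / r) ≤
      3 * (2 * Real.pi * Real.exp 1) ^ n * P * Q * (1 / √(2 * (n : ℝ)) + 2 * d + d / ϑ) := by
  have hn' : (2 : ℝ) ≤ n := by exact_mod_cast hn
  have h0 := sq_mul_pow_le_two_pi_e hn
  set X := 3 * (2 * Real.pi * Real.exp 1) ^ n
  set Y : ℝ := (25 / 16) ^ n with hY
  have hY0 : 0 < Y := by positivity
  have hX0 : 0 ≤ X := le_trans (by positivity) h0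
  have hs : √(2 * (n : ℝ)) ≤ n := by
    rw [Real.sqrt_le_left (by linarith)]; nlinarith
  have hs0 : 0 < √(2 * (n : ℝ)) := Real.sqrt_pos.2 (by linarith)
  have hPQ : P ≤ P * Q := le_mul_of_one_le_right (by linarith) hQ
  have hPQ2 : 2 ≤ P * Q := hP.trans hPQ
  have hq : (0 : ℝ) ≤ 1 / √(2 * (n : ℝ)) := by positivity
  have hdϑ : 0 ≤ d / ϑ := by positivity
  have hX1 : 80 * n * Y * n ≤ X := by nlinarith
  have hX2 : 160 * n * Y ≤ X := by nlinarith [mul_pos (by linarith : (0 : ℝ) < n) hY0]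
  rw [mul_assoc X P Q]
  rcases min_choice (d / 4) (min ϑ (1 / (20 * P * Q))) with h | h
  · rw [hr, h]
    have h1 : d / (d / 4) = 4 := by field_simp
    have h2 : 80 * n * Y ≤ X * (1 / √(2 * (n : ℝ))) := by
      rw [mul_one_div, le_div_iff₀ hs0]
      refine le_trans ?_ hX1
      gcongr
    rw [h1]
    calc 16 * n * Y * 4 ≤ 80 * n * Y * 2 := by nlinarith [mul_pos (by linarith : (0 : ℝ) < n) hY0]
      _ ≤ X * (1 / √(2 * (n : ℝ))) * (P * Q) := by gcongr
      _ = X * (P * Q) * (1 / √(2 * (n : ℝ))) := by ring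
      _ ≤ _ := by gcongr; linarith
  · rcases min_choice ϑ (1 / (20 * P * Q)) with h' | h'
    · rw [hr, h, h']
      calc 16 * n * Y * (d / ϑ) ≤ X * (d / ϑ) := by
            gcongr
            nlinarith [mul_pos (by linarith : (0 : ℝ) < n) hY0]
        _ ≤ X * (P * Q) * (d / ϑ) := by
            gcongr
            exact le_mul_of_one_le_right hX0 (by linarith)
        _ ≤ _ := by gcongr; linarith
    · rw [hr, h, h']
      calc 16 * n * Y * (d / (1 / (20 * P * Q))) = 160 * n * Y * (P * Q) * (2 * d) := by
            field_simp; ring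
        _ ≤ X * (P * Q) * (2 * d) := by gcongr
        _ ≤ _ := by gcongr; linarith

variable {V : Type*} [NormedAddCommGroup V] [InnerProductSpace ℝ V] [FiniteDimensional ℝ V]
  [MeasurableSpace V] [BorelSpace V]

/-- Measure of the set where a function close to a nondegenerate function is small. -/
theorem volume_normSq_le_le {n : ℕ} (hn : 2 ≤ n) (hV : Module.finrank ℝ V = 2 * n) {K : Set V}
    (hK : IsCompact K) (hd : 0 < Metric.diam K) {ϑ : ℝ} (hϑ : 0 < ϑ) {φ φ' : V → ℂ} {μ : ℕ} (hμ : 0 < μ)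
    (hφ : ∀ z ∈ Metric.thickening ϑ K, ContDiffAt ℝ (⊤ : ℕ∞) φ z)
    (hφ' : ContDiffOn ℝ μ φ' (Metric.thickening ϑ K)) {β F δ G : ℝ} (hβ : 0 < β)
    (hF : ∀ z ∈ Metric.thickening ϑ K, ∀ j ≤ μ, ∀ a : V, ‖a‖ = 1 → ‖dirDeriv j φ a z‖ ≤ F)
    (hδ : ∀ z ∈ Metric.thickening ϑ K, ∀ j ≤ μ, ∀ a : V, ‖a‖ = 1 →
      ‖dirDeriv j (fun z => φ z - φ' z) a z‖ ≤ δ)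
    (hG : ∀ z ∈ Metric.thickening ϑ K, ∀ j ≤ μ + 1, ∀ a : V, ‖a‖ = 1 →
      |dirDeriv j (fun z => ‖φ z‖ ^ 2) a z| ≤ G)
    (hδF : δ * (F + δ) ≤ β / 2 ^ (μ + 1)) (hβG : β ≤ G)
    (hy : ∀ y ∈ K, ∃ k ≤ μ, ∃ a : V, ‖a‖ = 1 ∧
      0.9999 * β ≤ |dirDeriv k (fun z => ‖φ z‖ ^ 2) a y|)
    {x : ℝ} (hx : 0 < x) :
    volume {y ∈ K | ‖φ' y‖ ^ 2 ≤ x ^ μ * β} ≤ ENNReal.ofReal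
      (3 * (2 * Real.pi * Real.exp 1) ^ n * (polarConst (μ + 1) * (μ + 1)) *
        Metric.diam K ^ (2 * n - 1) *
        (1 / √(2 * (n : ℝ)) + 2 * Metric.diam K + Metric.diam K / ϑ) * (G / β) * x) := by
  set d := Metric.diam K with hd'
  set P := polarConst (μ + 1) with hP'
  have hG0 : 0 < G := hβ.trans_le hβG
  have hP2 : (2 : ℝ) ≤ P :=
    le_trans (by simpa using pow_le_pow_right₀ (by norm_num : (1 : ℝ) ≤ 2) hμ)
      (two_pow_le_polarConst μ)
  have hQ : 1 ≤ G / β := (one_le_div hβ).2 hβG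
  -- The three constraints keep d + r ≤ 5d/4, keep the balls inside the thickening, and limit the
  -- variation of the derivatives to β/20.
  set r := min (d / 4) (min ϑ (1 / (20 * P * (G / β)))) with hr
  have hr0 : 0 < r := by
    refine lt_min (by positivity) (lt_min hϑ (by positivity))
  have hrd : r ≤ d / 4 := min_le_left _ _
  have hrϑ : r ≤ ϑ := (min_le_right _ _).trans (min_le_left _ _)
  have hrG : r * (P * G) ≤ β / 20 := by
    have : r ≤ 1 / (20 * P * (G / β)) := (min_le_right _ _).trans (min_le_right _ _)
    calc r * (P * G) ≤ 1 / (20 * P * (G / β)) * (P * G) := by gcongr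
      _ = β / 20 := by field_simp
  have hKW : K ⊆ Metric.thickening ϑ K := Metric.self_subset_thickening hϑ K
  set A := {y ∈ K | ‖φ' y‖ ^ 2 ≤ x ^ μ * β} with hA
  have hAc : IsClosed A := by
    have : A = K ∩ (fun y => ‖φ' y‖ ^ 2) ⁻¹' Set.Iic (x ^ μ * β) := rfl
    rw [this]
    exact ((hφ'.continuousOn.mono hKW).norm.pow 2).preimage_isClosed_of_isClosed hK.isClosed isClosed_Iic
  have hloc : ∀ x₀ : V, (A ∩ Metric.ball x₀ (r / 2)).Nonempty → ∃ a : V, ‖a‖ = 1 ∧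
      ∀ z : V, volume {t : ℝ | z + t • a ∈ A ∩ Metric.ball x₀ (r / 2)} ≤
        ENNReal.ofReal (8 * (μ + 1) * x) := by
    rintro x₀ ⟨y, ⟨hyK, hyA⟩, hyx⟩
    obtain ⟨k, hk, a, ha, hka⟩ := hy y hyK
    -- A section of a ball of radius r/2 has length at most r, so for r ≤ 8(μ+1)x the bound is
    -- trivial and x need not be small.
    rcases le_or_gt r (8 * (μ + 1) * x) with hle | hlt
    · refine ⟨a, ha, fun z => (Real.volume_le_diam _).trans ?_⟩
      refine Metric.ediam_le fun s hs t ht => ?_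
      rw [edist_dist]
      refine ENNReal.ofReal_le_ofReal (le_trans ?_ hle)
      have h1 : dist (z + s • a) (z + t • a) ≤ r / 2 + r / 2 :=
        (dist_triangle_right _ _ x₀).trans (add_le_add (Metric.mem_ball.1 hs.2).le
          (Metric.mem_ball.1 ht.2).le)
      rw [dist_add_left, dist_eq_norm, ← sub_smul, norm_smul, ha, mul_one] at h1
      rw [Real.dist_eq]
      linarith [Real.norm_eq_abs (s - t)]
    · have hball : Metric.ball y r ⊆ Metric.thickening ϑ K := fun z hz =>
        Metric.mem_thickening_iff.2 ⟨y, hyK, (Metric.mem_ball.1 hz).trans_le hrϑ⟩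
      obtain ⟨a, ha, hsec⟩ := exists_direction_section_le Metric.isOpen_thickening hμ hφ hφ' hβ hF hδ hG
        hδF hβG hball hr0 hrG ⟨k, hk, a, ha, hka⟩ hx hlt
      refine ⟨a, ha, fun z => hsec z _ fun t ht => ⟨?_, ht.1.2⟩⟩
      have h1 := dist_triangle_right (z + t • a) y x₀
      have h2 := Metric.mem_ball.1 ht.2
      have h3 := Metric.mem_ball.1 hyx
      exact Metric.mem_ball.2 (by linarith)
  refine (volume_le_of_local_sections hn hV hAc.measurableSet (fun y hy => hy.1) hK.isBounded
    (half_pos hr0) hloc).trans (ENNReal.ofReal_le_ofReal ?_)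
  have hnum := diam_div_radius_le hn hd hϑ hP2 hQ hr
  obtain ⟨k, hk⟩ : ∃ k, 2 * n = k + 1 := ⟨2 * n - 1, by omega⟩
  have hpow : (d + 2 * (r / 2)) ^ (2 * n) ≤ (25 / 16) ^ n * d ^ (2 * n) := by
    calc (d + 2 * (r / 2)) ^ (2 * n) ≤ (5 / 4 * d) ^ (2 * n) := by gcongr; linarith
      _ = _ := by rw [mul_pow, pow_mul (5 / 4 : ℝ)]; norm_num
  calc (d + 2 * (r / 2)) ^ (2 * n) * (n / (r / 2)) * (8 * (μ + 1) * x)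
      ≤ (25 / 16) ^ n * d ^ (2 * n) * (n / (r / 2)) * (8 * (μ + 1) * x) := by gcongr
    _ = 16 * n * (25 / 16) ^ n * (d / r) * (d ^ (2 * n - 1) * ((μ + 1) * x)) := by
        rw [hk, Nat.add_sub_cancel, pow_succ]; field_simp; ring
    _ ≤ 3 * (2 * Real.pi * Real.exp 1) ^ n * P * (G / β) * (1 / √(2 * (n : ℝ)) + 2 * d + d / ϑ) *
          (d ^ (2 * n - 1) * ((μ + 1) * x)) := by gcongr
    _ = _ := by ring

end MeasureEstimate

/-! ### Counting weights in dyadic blocks and summing. -/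

section DegreeBlocks

/-- The pairs `(Q, i)` with `2^(k-1) + 1 ≤ |Q| ≤ 2^k`. -/
def degreeBlock (n k : ℕ) : Finset ((Fin n → ℕ) × Fin n) :=
  ((Finset.Icc (2 ^ (k - 1) + 1) (2 ^ k)).biUnion fun m => Finset.piAntidiag Finset.univ m) ×ˢ
    Finset.univ

theorem mem_degreeBlock {n k : ℕ} {p : (Fin n → ℕ) × Fin n} :
    p ∈ degreeBlock n k ↔ 2 ^ (k - 1) + 1 ≤ ∑ j, p.1 j ∧ ∑ j, p.1 j ≤ 2 ^ k := by
  simp [degreeBlock]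

theorem card_piAntidiag_univ_fin (n m : ℕ) :
    (Finset.piAntidiag (Finset.univ : Finset (Fin n)) m).card = (n + m - 1).choose m := by
  rw [← Finset.map_sym_eq_piAntidiag, Finset.card_map, Finset.sym_univ, Finset.card_univ,
    Sym.card_sym_eq_choose, Fintype.card_fin]

/-- There are 2^(k-1) degrees m, each with C(n+m-1, n-1) exponents Q, and n choices of i. -/
theorem card_degreeBlock_le {n k : ℕ} (hn : 2 ≤ n) (hk : 1 ≤ k) :
    ((degreeBlock n k).card : ℝ) ≤
      n * 2 ^ (k - 1) * (2 ^ k + n + 1) ^ (n - 1) / ((n - 1).factorial : ℝ) := by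
  have h1 : ∀ m ∈ Finset.Icc (2 ^ (k - 1) + 1) (2 ^ k),
      ((Finset.piAntidiag (Finset.univ : Finset (Fin n)) m).card : ℝ) ≤
        ((2 : ℝ) ^ k + n + 1) ^ (n - 1) / ((n - 1).factorial : ℝ) := by
    intro m hm
    rw [card_piAntidiag_univ_fin, Nat.choose_symm_of_eq_add (b := n - 1) (by omega)]
    refine (Nat.choose_le_pow_div (α := ℝ) _ _).trans ?_
    gcongr
    have h2 : n + m - 1 ≤ 2 ^ k + n + 1 := by have := (Finset.mem_Icc.1 hm).2; omega
    exact_mod_cast h2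
  rw [degreeBlock, Finset.card_product, Finset.card_univ, Fintype.card_fin]
  push_cast
  have h3 := (Nat.cast_le (α := ℝ)).2 (Finset.card_biUnion_le
    (s := Finset.Icc (2 ^ (k - 1) + 1) (2 ^ k))
    (t := fun m => Finset.piAntidiag (Finset.univ : Finset (Fin n)) m))
  push_cast at h3
  have h4 := h3.trans (Finset.sum_le_sum h1)
  rw [Finset.sum_const, Nat.card_Icc, nsmul_eq_mul] at h4
  have h5 : 2 ^ k + 1 - (2 ^ (k - 1) + 1) = 2 ^ (k - 1) := by
    obtain ⟨j, rfl⟩ : ∃ j, k = j + 1 := ⟨k - 1, by omega⟩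
    rw [Nat.add_sub_cancel, pow_succ]; omega
  rw [h5] at h4
  push_cast at h4
  calc _ ≤ 2 ^ (k - 1) * (((2 : ℝ) ^ k + n + 1) ^ (n - 1) / ((n - 1).factorial : ℝ)) * n := by
        gcongr
    _ = _ := by ring

/-- After two explicit terms the sum is dominated by a telescoping one: y/(2y+3)² ≤ 1/(y+3) -
1/(2y+3) with y = 2^k. -/
theorem sum_two_pow_div_sq_le (N : ℕ) :
    ∑ k ∈ Finset.range N, (2 : ℝ) ^ k / (2 ^ (k + 1) + 3) ^ 2 ≤ 0.224 := by
  have h : ∀ N : ℕ, ∑ k ∈ Finset.range (N + 2), (2 : ℝ) ^ k / (2 ^ (k + 1) + 3) ^ 2 ≤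
      0.224 - 1 / (2 ^ (N + 2) + 3) := by
    intro N
    induction N with
    | zero => norm_num [Finset.sum_range_succ]
    | succ N ih =>
      rw [Finset.sum_range_succ]
      have h1 : (2 : ℝ) ^ (N + 2) / (2 ^ (N + 2 + 1) + 3) ^ 2 ≤
          1 / (2 ^ (N + 2) + 3) - 1 / (2 ^ (N + 1 + 2) + 3) := by
        have h2 : (0 : ℝ) < 2 ^ (N + 2) := by positivity
        have h3 : (2 : ℝ) ^ (N + 2 + 1) = 2 * 2 ^ (N + 2) := by ring
        rw [h3]
        generalize (2 : ℝ) ^ (N + 2) = y at h2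
        rw [div_sub_div _ _ (by positivity) (by positivity), div_le_div_iff₀ (by positivity) (by positivity)]
        have : 0 ≤ y * (2 * y + 3) * y := by positivity
        nlinarith
      simp only [show N + 1 + 2 = N + 2 + 1 from rfl] at *
      linarith
  have h2 : ∑ k ∈ Finset.range N, (2 : ℝ) ^ k / (2 ^ (k + 1) + 3) ^ 2 ≤
      ∑ k ∈ Finset.range (N + 2), (2 : ℝ) ^ k / (2 ^ (k + 1) + 3) ^ 2 :=
    Finset.sum_le_sum_of_subset_of_nonneg (Finset.range_mono (by omega)) fun _ _ _ => by positivity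
  have h3 : (0 : ℝ) ≤ 1 / (2 ^ (N + 2) + 3) := by positivity
  linarith [h N]

/-- The negative term costs at most 0.012 n M, because n + 1 ≤ 0.012 n (n+3)³ (an equality at n =
2), and 1/4 - 0.012 > 0.224. -/
theorem mul_le_threshold {n : ℕ} (hn : 2 ≤ n) {a₁ a₂ M : ℝ} (ha₂ : 0 ≤ a₂) (hM : 0 ≤ M)
    (h1 : ((2 : ℝ) ^ 1 + n + 1) ^ (n + 1) * a₁ ≤ M) :
    n * (0.224 * M) ≤ (2 ^ 2 + (n : ℝ)) ^ n * a₂ - ((n : ℝ) + 1) * a₁ + (n : ℝ) / 4 * M := by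
  have hn' : (2 : ℝ) ≤ n := by exact_mod_cast hn
  have h2 : ((n : ℝ) + 1) * a₁ ≤ 0.012 * n * M := by
    rcases le_or_gt a₁ 0 with h | h
    · have : ((n : ℝ) + 1) * a₁ ≤ 0 := mul_nonpos_of_nonneg_of_nonpos (by linarith) h
      have : 0 ≤ 0.012 * n * M := by positivity
      linarith
    · have h3 : ((n : ℝ) + 3) ^ 3 ≤ ((2 : ℝ) ^ 1 + n + 1) ^ (n + 1) := by
        rw [show (2 : ℝ) ^ 1 + n + 1 = n + 3 by ring]
        exact pow_le_pow_right₀ (by linarith) (by omega)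
      have h4 : (n : ℝ) + 1 ≤ 0.012 * n * (n + 3) ^ 3 := by
        nlinarith [mul_nonneg (by linarith : (0 : ℝ) ≤ n) (by positivity : (0 : ℝ) ≤ (n : ℝ) ^ 2), sq_nonneg ((n : ℝ) - 2)]
      calc ((n : ℝ) + 1) * a₁ ≤ 0.012 * n * (n + 3) ^ 3 * a₁ := by gcongr
        _ = 0.012 * n * ((n + 3) ^ 3 * a₁) := by ring
        _ ≤ 0.012 * n * (((2 : ℝ) ^ 1 + n + 1) ^ (n + 1) * a₁) := by gcongr
        _ ≤ _ := by gcongr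
  have h5 : 0 ≤ (2 ^ 2 + (n : ℝ)) ^ n * a₂ := by positivity
  generalize (2 ^ 2 + (n : ℝ)) ^ n * a₂ = y at h5 ⊢
  generalize ((n : ℝ) + 1) * a₁ = z at h2 ⊢
  have h6 : 0 ≤ (n : ℝ) * M := by positivity
  nlinarith

theorem sum_card_degreeBlock_mul_le {n : ℕ} (hn : 2 ≤ n) {a : ℕ → ℝ} {M : ℝ}
    (ha : ∀ k, 1 ≤ k → 0 ≤ a k) (hM : ∀ k : ℕ, 1 ≤ k → ((2 : ℝ) ^ k + n + 1) ^ (n + 1) * a k ≤ M)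
    (N : ℕ) :
    ∑ k ∈ Finset.range N, ((degreeBlock n (k + 1)).card : ℝ) * a (k + 1) ≤
      ((2 ^ 2 + (n : ℝ)) ^ n * a 2 - ((n : ℝ) + 1) * a 1 + (n : ℝ) / 4 * M) /
        ((n - 1).factorial : ℝ) := by
  have hn' : (2 : ℝ) ≤ n := by exact_mod_cast hn
  have hM0 : 0 ≤ M := le_trans (mul_nonneg (by positivity) (ha 1 le_rfl)) (hM 1 le_rfl)
  have hterm : ∀ k : ℕ, ((degreeBlock n (k + 1)).card : ℝ) * a (k + 1) ≤
      n * M / ((n - 1).factorial : ℝ) * ((2 : ℝ) ^ k / (2 ^ (k + 1) + 3) ^ 2) := by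
    intro k
    have h0 := ha (k + 1) (by omega)
    set X : ℝ := 2 ^ (k + 1) + n + 1 with hX
    have hX0 : 0 < X := by positivity
    have hX3 : (2 : ℝ) ^ (k + 1) + 3 ≤ X := by rw [hX]; linarith
    have h1 := card_degreeBlock_le hn (k := k + 1) (by omega)
    rw [Nat.add_sub_cancel, ← hX] at h1
    -- Of the n+1 powers of X controlled by M, n-1 pay for the number of weights and two for the
    -- convergence of the series.
    have h2 : X ^ (n - 1) * a (k + 1) ≤ M / (2 ^ (k + 1) + 3) ^ 2 := by
      rw [le_div_iff₀ (by positivity)]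
      calc X ^ (n - 1) * a (k + 1) * (2 ^ (k + 1) + 3) ^ 2 ≤ X ^ (n - 1) * a (k + 1) * X ^ 2 := by
            gcongr
        _ = X ^ (n + 1) * a (k + 1) := by
            rw [show n + 1 = (n - 1) + 2 by omega, pow_add]; ring
        _ ≤ M := hM (k + 1) (by omega)
    calc ((degreeBlock n (k + 1)).card : ℝ) * a (k + 1)
        ≤ n * 2 ^ k * X ^ (n - 1) / ((n - 1).factorial : ℝ) * a (k + 1) := by gcongr
      _ = n * 2 ^ k / ((n - 1).factorial : ℝ) * (X ^ (n - 1) * a (k + 1)) := by ring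
      _ ≤ n * 2 ^ k / ((n - 1).factorial : ℝ) * (M / (2 ^ (k + 1) + 3) ^ 2) := by gcongr
      _ = _ := by ring
  refine (Finset.sum_le_sum fun k _ => hterm k).trans ?_
  rw [← Finset.mul_sum]
  calc _ ≤ n * M / ((n - 1).factorial : ℝ) * 0.224 := by
        gcongr
        exact sum_two_pow_div_sq_le N
    _ = n * (0.224 * M) / ((n - 1).factorial : ℝ) := by ring
    _ ≤ _ := by
        gcongr
        exact mul_le_threshold hn (ha 2 (by omega)) hM0 (hM 1 le_rfl)

end DegreeBlocks

/-! ### From the extended-valued C^p norms to bounds on directional derivatives. -/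

section CkNormBounds

variable {E F : Type*} [NormedAddCommGroup E] [NormedSpace ℝ E]
  [NormedAddCommGroup F] [NormedSpace ℝ F]

theorem ckNormAt_le_ckNormOn {B : Set E} {y : E} (hy : y ∈ B) (p : ℕ) (f : E → F) :
    ckNormAt p f y ≤ ckNormOn B p f :=
  le_iSup₂_of_le y hy le_rfl

theorem enorm_dirDeriv_le_ckNormAt {p j : ℕ} (hj : j ≤ p) (f : E → F) {a : E} (ha : ‖a‖ = 1) (y : E) :
    ‖dirDeriv j f a y‖ₑ ≤ ckNormAt p f y :=
  le_iSup₂_of_le j hj (le_iSup₂_of_le a ha le_rfl)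

theorem norm_dirDeriv_le_of_ckNormOn_le {B : Set E} {p j : ℕ} {f : E → F} {C : ℝ} (hC : 0 ≤ C)
    (h : ckNormOn B p f ≤ ENNReal.ofReal C) {y : E} (hy : y ∈ B) (hj : j ≤ p) {a : E} (ha : ‖a‖ = 1) :
    ‖dirDeriv j f a y‖ ≤ C := by
  have h1 := (enorm_dirDeriv_le_ckNormAt hj f ha y).trans ((ckNormAt_le_ckNormOn hy p f).trans h)
  rwa [← ofReal_norm, ENNReal.ofReal_le_ofReal_iff hC] at h1

theorem ckNormAt_le_ofReal {p : ℕ} {f : E → F} {y : E} {C : ℝ}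
    (h : ∀ j ≤ p, ∀ a : E, ‖a‖ = 1 → ‖dirDeriv j f a y‖ ≤ C) :
    ckNormAt p f y ≤ ENNReal.ofReal C := by
  refine iSup₂_le fun j hj => iSup₂_le fun a ha => ?_
  rw [← ofReal_norm]
  exact ENNReal.ofReal_le_ofReal (h j hj a ha)

theorem exists_le_norm_dirDeriv {p : ℕ} {f : E → F} {y : E} {C : ℝ}
    (h : ENNReal.ofReal C < ckNormAt p f y) :
    ∃ j ≤ p, ∃ a : E, ‖a‖ = 1 ∧ C ≤ ‖dirDeriv j f a y‖ := by
  by_contra! hcon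
  exact h.not_ge (ckNormAt_le_ofReal fun j hj a ha => (hcon j hj a ha).le)

theorem exists_norm_dirDeriv_le {U C : Set E} (hU : IsOpen U) {f : E → F}
    (hf : ∀ z ∈ U, ContDiffAt ℝ (⊤ : ℕ∞) f z) (hC : IsCompact C) (hCU : C ⊆ U) (p : ℕ) :
    ∃ R : ℝ, 0 ≤ R ∧ ∀ y ∈ C, ∀ j ≤ p, ∀ a : E, ‖a‖ = 1 → ‖dirDeriv j f a y‖ ≤ R := by
  have h1 : ∀ j : ℕ, ∃ R : ℝ, ∀ y ∈ C, ‖iteratedFDeriv ℝ j f y‖ ≤ R := fun j => by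
    have h2 : ContinuousOn (iteratedFDeriv ℝ j f) U := by
      have h3 : ContDiffOn ℝ j f U := fun z hz =>
        ((hf z hz).of_le (by exact_mod_cast le_top)).contDiffWithinAt
      exact (h3.continuousOn_iteratedFDerivWithin le_rfl hU.uniqueDiffOn).congr
        fun z hz => (iteratedFDerivWithin_of_isOpen j hU hz).symm
    exact hC.exists_bound_of_continuousOn (h2.mono hCU)
  choose R hR using h1
  refine ⟨∑ j ∈ Finset.range (p + 1), |R j|, by positivity, fun y hy j hj a ha => ?_⟩
  calc ‖dirDeriv j f a y‖ ≤ ‖iteratedFDeriv ℝ j f y‖ * ∏ _i : Fin j, ‖a‖ :=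
        (iteratedFDeriv ℝ j f y).le_opNorm _
    _ = ‖iteratedFDeriv ℝ j f y‖ := by simp [ha]
    _ ≤ |R j| := (hR j y hy).trans (le_abs_self _)
    _ ≤ _ := Finset.single_le_sum (f := fun j => |R j|) (fun _ _ => abs_nonneg _)
        (Finset.mem_range.2 (by omega))

end CkNormBounds

/-! ### The bilinear pairing (c, f) and thickenings of `K`. -/

section Pairing

variable {n l : ℕ}

/-- The linear form `x ↦ ∑ j, c_j x_j`. -/
noncomputable def pairing (c : CSpace l) : CSpace l →L[ℝ] ℂ :=
  (innerSL ℂ (WithLp.toLp 2 fun j => star (c j) : CSpace l)).restrictScalars ℝ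

theorem pairing_apply (c x : CSpace l) : pairing c x = ∑ j, c j * x j := by
  simp [pairing, PiLp.inner_apply, mul_comm]

theorem norm_pairing_apply_le (c x : CSpace l) : ‖pairing c x‖ ≤ ‖c‖ * ‖x‖ := by
  have h : ‖(WithLp.toLp 2 fun j => star (c j) : CSpace l)‖ = ‖c‖ := by
    simp [EuclideanSpace.norm_eq]
  have := norm_inner_le_norm (𝕜 := ℂ) (WithLp.toLp 2 fun j => star (c j) : CSpace l) x
  rwa [h] at this

theorem pairSq_eq (c : CSpace l) (f : CSpace n → CSpace l) :
    pairSq c f = fun y => ‖pairing c (f y)‖ ^ 2 := by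
  funext y; rw [pairSq, pairing_apply]

theorem norm_dirDeriv_pairing_le {c : CSpace l} (hc : ‖c‖ = 1) {u : CSpace n → CSpace l} {j : ℕ}
    {y a : CSpace n} (hu : ContDiffAt ℝ j u y) {C : ℝ} (hC : ‖dirDeriv j u a y‖ ≤ C) :
    ‖dirDeriv j (fun z => pairing c (u z)) a y‖ ≤ C := by
  rw [dirDeriv_clm_comp (pairing c) hu a]
  refine (norm_pairing_apply_le c _).trans ?_
  rwa [hc, one_mul]

theorem finrank_real_CSpace : Module.finrank ℝ (CSpace n) = 2 * n := by
  rw [finrank_real_of_complex]; simp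

/-- The thickening of a compact set has bounded derivatives for a map smooth on a larger open set. -/
theorem exists_norm_dirDeriv_le_thickening {E F : Type*} [NormedAddCommGroup E] [NormedSpace ℝ E]
    [ProperSpace E] [NormedAddCommGroup F] [NormedSpace ℝ F]
    {U K : Set E} (hU : IsOpen U) (hK : IsCompact K) {ϑ : ℝ}
    (hϑU : Metric.cthickening ϑ K ⊆ U) {f : E → F}
    (hf : ∀ z ∈ U, ContDiffAt ℝ (⊤ : ℕ∞) f z) (p : ℕ) :
    ∃ R : ℝ, 0 ≤ R ∧ ∀ y ∈ Metric.thickening ϑ K, ∀ j ≤ p, ∀ a : E, ‖a‖ = 1 →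
      ‖dirDeriv j f a y‖ ≤ R := by
  obtain ⟨R, h0, hR⟩ := exists_norm_dirDeriv_le hU hf hK.cthickening hϑU p
  exact ⟨R, h0, fun y hy => hR y (Metric.thickening_subset_cthickening _ _ hy)⟩

/-- A point outside `U` is at distance at least the infimum from `K`. The strict inequality makes
even the closed thickening fit, and its compactness later bounds the derivatives. For `U` the whole
space the infimum is ∞. -/
theorem cthickening_subset_of_lt_iInf {E : Type*} [PseudoEMetricSpace E]
    {U K : Set E} {ϑ : ℝ}
    (h : ENNReal.ofReal ϑ < ⨅ x ∈ K, Metric.infEDist x Uᶜ) : Metric.cthickening ϑ K ⊆ U := by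
  intro z hz
  by_contra hzU
  rw [Metric.mem_cthickening_iff] at hz
  have h1 : ⨅ x ∈ K, Metric.infEDist x Uᶜ ≤ Metric.infEDist z K := by
    refine Metric.le_infEDist.2 fun x hx => ?_
    refine (iInf₂_le x hx).trans ?_
    rw [edist_comm]
    exact Metric.infEDist_le_edist_of_mem hzU
  exact (h1.trans hz).not_gt h

end Pairing

/-! ### The sublevel estimate for nondegenerate maps. -/

section NondegenerateMeasure

variable {n l : ℕ}

theorem constB_eq (n μ : ℕ) :
    constB n μ = 3 * (2 * Real.pi * Real.exp 1) ^ n * (polarConst (μ + 1) * (μ + 1)) := by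
  rw [constB, polarConst, pow_succ ((μ : ℝ) + 1) (μ + 1)]
  push_cast
  ring

theorem closenessBound_nonneg (f : CSpace n → CSpace l) (K : Set (CSpace n)) (ϑ : ℝ) :
    0 ≤ closenessBound f K ϑ := by
  rw [closenessBound]
  have h : (0 : ℝ) ≤ nondegAmount f K / (2 : ℝ) ^ ((nondegIndex f K : ℤ) - 1) :=
    div_nonneg ENNReal.toReal_nonneg (by positivity)
  have := Real.le_sqrt_of_sq_le (le_add_of_nonneg_right h :
    (ckNormOn (Metric.thickening ϑ K) (nondegIndex f K) f).toReal ^ 2 ≤ _)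
  linarith

/-- The closeness bound is the nonnegative root t of t(F + t) = β/2^(μ₀+1), the form in which the
derivative estimates use it. -/
theorem closenessBound_mul_add (f : CSpace n → CSpace l) (K : Set (CSpace n)) (ϑ : ℝ) :
    closenessBound f K ϑ *
      ((ckNormOn (Metric.thickening ϑ K) (nondegIndex f K) f).toReal + closenessBound f K ϑ) =
      nondegAmount f K / 2 ^ (nondegIndex f K + 1) := by
  rw [closenessBound]
  have h : (0 : ℝ) ≤ nondegAmount f K / (2 : ℝ) ^ ((nondegIndex f K : ℤ) - 1) :=
    div_nonneg ENNReal.toReal_nonneg (by positivity)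
  have hs := Real.sq_sqrt (add_nonneg (sq_nonneg
    (ckNormOn (Metric.thickening ϑ K) (nondegIndex f K) f).toReal) h)
  have h2 : nondegAmount f K / (2 : ℝ) ^ ((nondegIndex f K : ℤ) - 1) =
      4 * (nondegAmount f K / 2 ^ (nondegIndex f K + 1)) := by
    rw [zpow_sub_one₀ two_ne_zero, zpow_natCast, pow_succ]
    field_simp
    norm_num
  rw [h2] at hs ⊢
  generalize √_ = s at hs ⊢
  linear_combination hs / 4

/-- The supremum of `‖|(c,f)|²‖_{K_ϑ,p}` over unit vectors `c` is finite. -/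
theorem iSup_ckNormOn_pairSq_ne_top {U K : Set (CSpace n)} (hU : IsOpen U) (hK : IsCompact K) {ϑ : ℝ}
    (hϑU : Metric.cthickening ϑ K ⊆ U) {f : CSpace n → CSpace l}
    (hf : ∀ z ∈ U, ContDiffAt ℝ (⊤ : ℕ∞) f z) (p : ℕ) :
    (⨆ c : CSpace l, ⨆ _ : ‖c‖ = 1, ckNormOn (Metric.thickening ϑ K) p (pairSq c f)) ≠ ⊤ := by
  obtain ⟨R, hR0, hR⟩ := exists_norm_dirDeriv_le_thickening hU hK hϑU hf p
  have hsub : Metric.thickening ϑ K ⊆ U := (Metric.thickening_subset_cthickening _ _).trans hϑU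
  refine ne_top_of_le_ne_top (ENNReal.ofReal_ne_top (r := 2 ^ p * R ^ 2))
    (iSup₂_le fun c hc => iSup₂_le fun y hy => ckNormAt_le_ofReal fun j hj a ha => ?_)
  have hs : ∀ z ∈ Metric.thickening ϑ K, ∀ m : ℕ, ContDiffAt ℝ m f z := fun z hz m =>
    (hf z (hsub hz)).of_le (by exact_mod_cast le_top)
  rw [pairSq_eq, Real.norm_eq_abs]
  refine (abs_dirDeriv_normSq_le (C := R) Metric.isOpen_thickening
    (fun z hz => ((pairing c).contDiff.contDiffAt.comp z (hs z hz j)).contDiffWithinAt) hy a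
    fun i hi => norm_dirDeriv_pairing_le hc (hs y hy i) (hR y hy i (hi.trans hj) a ha)).trans ?_
  gcongr
  norm_num

/-- Ensures that the `toReal` in `closenessBound` is a genuine norm and not the default value 0. -/
theorem ckNormOn_ne_top {U K : Set (CSpace n)} (hU : IsOpen U) (hK : IsCompact K) {ϑ : ℝ}
    (hϑU : Metric.cthickening ϑ K ⊆ U) {f : CSpace n → CSpace l}
    (hf : ∀ z ∈ U, ContDiffAt ℝ (⊤ : ℕ∞) f z) (p : ℕ) :
    ckNormOn (Metric.thickening ϑ K) p f ≠ ⊤ := by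
  obtain ⟨R, hR0, hR⟩ := exists_norm_dirDeriv_le_thickening hU hK hϑU hf p
  exact ne_top_of_le_ne_top ENNReal.ofReal_ne_top
    (iSup₂_le fun y hy => ckNormAt_le_ofReal fun j hj a ha => hR y hy j hj a ha)

theorem nondegBeta_le_ckNormAt {μ : ℕ} {f : CSpace n → CSpace l} {K : Set (CSpace n)} {y : CSpace n}
    (hy : y ∈ K) {c : CSpace l} (hc : ‖c‖ = 1) : nondegBeta μ f K ≤ ckNormAt μ (pairSq c f) y :=
  iInf₂_le_of_le y hy (iInf₂_le c hc)

theorem ckNormOn_mono {E F : Type*} [NormedAddCommGroup E] [NormedSpace ℝ E]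
    [NormedAddCommGroup F] [NormedSpace ℝ F] {B : Set E} {p q : ℕ} (hpq : p ≤ q) (f : E → F) :
    ckNormOn B p f ≤ ckNormOn B q f :=
  iSup₂_mono fun _ _ => iSup_mono fun _ => iSup_mono' fun h => ⟨h.trans hpq, le_rfl⟩

theorem volume_pairSq_le (hn : 2 ≤ n) {U K : Set (CSpace n)} (hU : IsOpen U)
    (hK : IsCompact K) (hKne : K.Nonempty) (hd : 0 < Metric.diam K) {ϑ : ℝ} (hϑ : 0 < ϑ)
    (hϑU : Metric.cthickening ϑ K ⊆ U) {f f' : CSpace n → CSpace l}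
    (hf : ∀ z ∈ U, ContDiffAt ℝ (⊤ : ℕ∞) f z)
    (hf' : ContDiffOn ℝ (nondegIndex f K) f' (Metric.thickening ϑ K))
    (hclose : ckNormOn (Metric.thickening ϑ K) (nondegIndex f K) (fun y => f y - f' y) ≤
      ENNReal.ofReal (closenessBound f K ϑ))
    (hμ : 0 < nondegIndex f K) {c : CSpace l} (hc : ‖c‖ = 1) {x : ℝ} (hx : 0 < x) :
    0 < nondegAmount f K ∧
    volume {y ∈ K | ‖pairing c (f' y)‖ ^ 2 ≤ x ^ nondegIndex f K * nondegAmount f K} ≤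
      ENNReal.ofReal (constM f K ϑ * nondegAmount f K ^ (1 / (nondegIndex f K : ℝ)) * x) := by
  have hKT : K ⊆ Metric.thickening ϑ K := Metric.self_subset_thickening hϑ K
  have hsub : Metric.thickening ϑ K ⊆ U := (Metric.thickening_subset_cthickening _ _).trans hϑU
  -- `sInf ∅ = 0` in ℕ, so a positive index means that the minimum defining it is attained.
  have hpos : 0 < nondegBeta (nondegIndex f K) f K := by
    have hne : {N : ℕ | 0 < N ∧ 0 < nondegBeta N f K}.Nonempty := by
      by_contra h
      rw [Set.not_nonempty_iff_eq_empty] at h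
      rw [nondegIndex, h, Nat.sInf_empty] at hμ
      exact hμ.false
    exact (Nat.sInf_mem hne).2
  set μ := nondegIndex f K with hμdef
  set Gsup := ⨆ c : CSpace l, ⨆ _ : ‖c‖ = 1,
    ckNormOn (Metric.thickening ϑ K) (μ + 1) (pairSq c f) with hGsup
  have hGtop : Gsup ≠ ⊤ := iSup_ckNormOn_pairSq_ne_top hU hK hϑU hf (μ + 1)
  have hcG : ∀ c : CSpace l, ‖c‖ = 1 →
      ckNormOn (Metric.thickening ϑ K) (μ + 1) (pairSq c f) ≤ ENNReal.ofReal Gsup.toReal := by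
    intro c hc
    rw [ENNReal.ofReal_toReal hGtop]
    exact le_iSup₂_of_le c hc le_rfl
  obtain ⟨y₀, hy₀⟩ := hKne
  have hβG : nondegBeta μ f K ≤ Gsup :=
    calc nondegBeta μ f K ≤ ckNormAt μ (pairSq c f) y₀ := nondegBeta_le_ckNormAt hy₀ hc
      _ ≤ ckNormOn (Metric.thickening ϑ K) μ (pairSq c f) := ckNormAt_le_ckNormOn (hKT hy₀) _ _
      _ ≤ ckNormOn (Metric.thickening ϑ K) (μ + 1) (pairSq c f) := ckNormOn_mono (by omega) _
      _ ≤ Gsup := le_iSup₂_of_le c hc le_rfl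
  have hβtop : nondegBeta μ f K ≠ ⊤ := ne_top_of_le_ne_top hGtop hβG
  have hβ : 0 < nondegAmount f K := ENNReal.toReal_pos hpos.ne' hβtop
  have hβeq : ENNReal.ofReal (nondegAmount f K) = nondegBeta μ f K := ENNReal.ofReal_toReal hβtop
  have hs : ∀ z ∈ Metric.thickening ϑ K, ∀ m : ℕ, ContDiffAt ℝ m f z := fun z hz m =>
    (hf z (hsub hz)).of_le (by exact_mod_cast le_top)
  have hs' : ∀ z ∈ Metric.thickening ϑ K, ContDiffAt ℝ μ f' z := fun z hz =>
    hf'.contDiffAt (Metric.isOpen_thickening.mem_nhds hz)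
  refine ⟨hβ, ?_⟩
  have hmain := volume_normSq_le_le hn finrank_real_CSpace hK hd hϑ
    (φ := fun y => pairing c (f y)) (φ' := fun y => pairing c (f' y)) hμ
    (fun z hz => (pairing c).contDiff.contDiffAt.comp z (hf z (hsub hz)))
    ((pairing c).contDiff.comp_contDiffOn hf') hβ
    (F := (ckNormOn (Metric.thickening ϑ K) μ f).toReal) (δ := closenessBound f K ϑ)
    (G := Gsup.toReal)
    (fun z hz j hj a ha => norm_dirDeriv_pairing_le hc (hs z hz j)
      (norm_dirDeriv_le_of_ckNormOn_le ENNReal.toReal_nonneg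
        (ENNReal.ofReal_toReal (ckNormOn_ne_top hU hK hϑU hf μ)).ge hz hj ha))
    (fun z hz j hj a ha => by
      have h := norm_dirDeriv_pairing_le hc (u := fun z => f z - f' z)
        ((hs z hz j).sub ((hs' z hz).of_le (by exact_mod_cast hj)))
        (norm_dirDeriv_le_of_ckNormOn_le (closenessBound_nonneg f K ϑ) hclose hz hj ha)
      simpa only [map_sub] using h)
    (fun z hz j hj a ha => by
      have h := norm_dirDeriv_le_of_ckNormOn_le ENNReal.toReal_nonneg (hcG c hc) hz hj ha
      rwa [pairSq_eq, Real.norm_eq_abs] at h)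
    (closenessBound_mul_add f K ϑ).le
    (ENNReal.toReal_mono hGtop hβG)
    (fun y hy => by
      -- β bounds a supremum over orders and directions; the loss from 1 to 0.9999 lets an actual
      -- order and direction be chosen.
      have h1 : ENNReal.ofReal (0.9999 * nondegAmount f K) < ckNormAt μ (pairSq c f) y := by
        refine lt_of_lt_of_le ?_ (nondegBeta_le_ckNormAt hy hc)
        rw [← hβeq]
        exact (ENNReal.ofReal_lt_ofReal_iff hβ).2 (by linarith)
      obtain ⟨j, hj, a, ha, h2⟩ := exists_le_norm_dirDeriv h1
      rw [pairSq_eq, Real.norm_eq_abs] at h2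
      exact ⟨j, hj, a, ha, h2⟩) hx
  refine hmain.trans (ENNReal.ofReal_le_ofReal (le_of_eq ?_))
  have hpow : nondegAmount f K ^ (-1 / (μ : ℝ) - 1) * nondegAmount f K ^ (1 / (μ : ℝ)) =
      (nondegAmount f K)⁻¹ := by
    rw [← Real.rpow_add hβ, ← Real.rpow_neg_one]
    congr 1; ring
  rw [constM, constB_eq, ← hμdef, ← hGsup, div_eq_mul_inv Gsup.toReal, ← hpow]
  ring

theorem constM_nonneg (f : CSpace n → CSpace l) (K : Set (CSpace n)) {ϑ : ℝ} (hϑ : 0 < ϑ) :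
    0 ≤ constM f K ϑ := by
  have h1 : 0 ≤ nondegAmount f K := ENNReal.toReal_nonneg
  have h2 : 0 ≤ constB n (nondegIndex f K) := by
    have := Real.pi_pos
    rw [constB]; positivity
  have h3 : 0 ≤ Metric.diam K := Metric.diam_nonneg
  rw [constM]
  positivity

theorem volume_norm_pairing_lt_le (hn : 2 ≤ n) {U K : Set (CSpace n)} (hU : IsOpen U)
    (hK : IsCompact K) (hKne : K.Nonempty) (hd : 0 < Metric.diam K) {ϑ : ℝ} (hϑ : 0 < ϑ)
    (hϑU : Metric.cthickening ϑ K ⊆ U) {f f' : CSpace n → CSpace l}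
    (hf : ∀ z ∈ U, ContDiffAt ℝ (⊤ : ℕ∞) f z)
    (hf' : ContDiffOn ℝ (nondegIndex f K) f' (Metric.thickening ϑ K))
    (hclose : ckNormOn (Metric.thickening ϑ K) (nondegIndex f K) (fun y => f y - f' y) ≤
      ENNReal.ofReal (closenessBound f K ϑ))
    (hμ : 0 < nondegIndex f K) {c : CSpace l} {w s : ℝ} (hw : 0 < w) (hwc : w ≤ ‖c‖) (hs : 0 < s) :
    volume {y ∈ K | ‖pairing c (f' y)‖ < s} ≤
      ENNReal.ofReal (constM f K ϑ * (s / w) ^ (2 / (nondegIndex f K : ℝ))) := by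
  have hc0 : 0 < ‖c‖ := hw.trans_le hwc
  set c₁ : CSpace l := ((‖c‖⁻¹ : ℝ) : ℂ) • c with hc₁
  have hc₁n : ‖c₁‖ = 1 := by
    rw [hc₁, norm_smul]
    simp [hc0.ne']
  have hpair : ∀ v, ‖pairing c₁ v‖ = ‖pairing c v‖ / ‖c‖ := by
    intro v
    have : pairing c₁ v = ((‖c‖⁻¹ : ℝ) : ℂ) * pairing c v := by
      simp [pairing_apply, hc₁, Finset.mul_sum, mul_assoc]
    rw [this, norm_mul, Complex.norm_real, norm_inv, norm_norm]
    field_simp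
  have hμ' : (0 : ℝ) < nondegIndex f K := by exact_mod_cast hμ
  have hβ := (volume_pairSq_le hn hU hK hKne hd hϑ hϑU hf hf' hclose hμ hc₁n one_pos).1
  set β := nondegAmount f K with hβdef
  have hsw : 0 < s / w := div_pos hs hw
  -- Chosen so that x^μ₀ β = (s/w)².
  set x := (s / w) ^ (2 / (nondegIndex f K : ℝ)) * β ^ (-1 / (nondegIndex f K : ℝ)) with hx
  have hx0 : 0 < x := by positivity
  have h := (volume_pairSq_le hn hU hK hKne hd hϑ hϑU hf hf' hclose hμ hc₁n hx0).2
  have hxμ : x ^ nondegIndex f K * β = (s / w) ^ 2 := by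
    rw [hx, mul_pow, ← Real.rpow_mul_natCast hsw.le, ← Real.rpow_mul_natCast hβ.le,
      div_mul_cancel₀ _ hμ'.ne', div_mul_cancel₀ _ hμ'.ne', Real.rpow_neg_one, mul_assoc,
      inv_mul_cancel₀ hβ.ne', mul_one]
    exact Real.rpow_natCast _ 2
  have hsub : {y ∈ K | ‖pairing c (f' y)‖ < s} ⊆
      {y ∈ K | ‖pairing c₁ (f' y)‖ ^ 2 ≤ x ^ nondegIndex f K * nondegAmount f K} := by
    rintro y ⟨hyK, hy⟩
    refine ⟨hyK, ?_⟩
    rw [← hβdef, hxμ, hpair]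
    gcongr
  refine (measure_mono hsub).trans (h.trans (ENNReal.ofReal_le_ofReal (le_of_eq ?_)))
  rw [hx, ← hβdef]
  have : β ^ (1 / (nondegIndex f K : ℝ)) * β ^ (-1 / (nondegIndex f K : ℝ)) = 1 := by
    rw [← Real.rpow_add hβ]
    simp [neg_div]
  linear_combination constM f K ϑ * (s / w) ^ (2 / (nondegIndex f K : ℝ)) * this

end NondegenerateMeasure

/-! ### Weights of `S` and the decomposition of the discarded set. -/

section Weights

variable {n l : ℕ} {𝔤 : Type*} [LieRing 𝔤] [LieAlgebra ℂ 𝔤]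

theorem finite_nonzeroWeights (S : 𝔤 →ₗ⁅ℂ⁆ Matrix (Fin n) (Fin n) ℂ) (k : ℕ) :
    (nonzeroWeights S (2 ^ (k - 1) + 1) (2 ^ k)).Finite := by
  refine ((degreeBlock n k).finite_toSet.image fun p => weightForm S p.1 p.2).subset ?_
  rintro α ⟨-, Q, i, h1, h2, rfl⟩
  exact ⟨(Q, i), mem_degreeBlock.2 ⟨h1, h2⟩, rfl⟩

theorem dualMaxNorm_nonneg (g : Module.Basis (Fin l) ℂ 𝔤) (α : Module.Dual ℂ 𝔤) :
    0 ≤ dualMaxNorm g α := Real.iSup_nonneg fun _ => norm_nonneg _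

theorem dualMaxNorm_pos (g : Module.Basis (Fin l) ℂ 𝔤) {α : Module.Dual ℂ 𝔤} (hα : α ≠ 0) :
    0 < dualMaxNorm g α := by
  obtain ⟨j, hj⟩ : ∃ j, α (g j) ≠ 0 := by
    by_contra! h
    exact hα (g.ext fun j => by simp [h j])
  exact (norm_pos_iff.2 hj).trans_le
    (le_ciSup (f := fun j => ‖α (g j)‖) (Set.finite_range _).bddAbove j)

theorem dualMaxNorm_le_norm (g : Module.Basis (Fin l) ℂ 𝔤) (α : Module.Dual ℂ 𝔤) :
    dualMaxNorm g α ≤ ‖(WithLp.toLp 2 fun j => α (g j) : CSpace l)‖ :=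
  Real.iSup_le (fun j => PiLp.norm_apply_le (WithLp.toLp 2 fun j => α (g j) : CSpace l) j)
    (norm_nonneg _)

theorem omegaS_nonneg (g : Module.Basis (Fin l) ℂ 𝔤) (S : 𝔤 →ₗ⁅ℂ⁆ Matrix (Fin n) (Fin n) ℂ) (k : ℕ) :
    0 ≤ omegaS g S k :=
  Real.sInf_nonneg (by rintro _ ⟨α, -, rfl⟩; exact dualMaxNorm_nonneg g α)

theorem omegaS_le (g : Module.Basis (Fin l) ℂ 𝔤) (S : 𝔤 →ₗ⁅ℂ⁆ Matrix (Fin n) (Fin n) ℂ) {k : ℕ}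
    {α : Module.Dual ℂ 𝔤} (hα : α ∈ nonzeroWeights S (2 ^ (k - 1) + 1) (2 ^ k)) :
    omegaS g S k ≤ dualMaxNorm g α :=
  csInf_le ((finite_nonzeroWeights S k).image _).bddBelow ⟨α, hα, rfl⟩

/-- A block contains finitely many weights, so the infimum is attained at a nonzero one. Without
nonzero weights `omegaS` takes the default value 0. -/
theorem omegaS_pos (g : Module.Basis (Fin l) ℂ 𝔤) (S : 𝔤 →ₗ⁅ℂ⁆ Matrix (Fin n) (Fin n) ℂ) {k : ℕ}
    {α : Module.Dual ℂ 𝔤} (hα : α ∈ nonzeroWeights S (2 ^ (k - 1) + 1) (2 ^ k)) :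
    0 < omegaS g S k := by
  have hne : (dualMaxNorm g '' nonzeroWeights S (2 ^ (k - 1) + 1) (2 ^ k)).Nonempty :=
    ⟨_, α, hα, rfl⟩
  obtain ⟨α', hα', h⟩ := hne.csInf_mem ((finite_nonzeroWeights S k).image (dualMaxNorm g))
  rw [omegaS, ← h]
  exact dualMaxNorm_pos g hα'.1

theorem ratioPow_nonneg {g : Module.Basis (Fin l) ℂ 𝔤} {S : 𝔤 →ₗ⁅ℂ⁆ Matrix (Fin n) (Fin n) ℂ}
    {ω : ℕ → ℝ} {μ₀ : ℕ} {k : ℕ} (h : 0 ≤ ω k) : 0 ≤ ratioPow g S ω μ₀ k :=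
  Real.rpow_nonneg (div_nonneg h (omegaS_nonneg g S k)) _

/-- For μ₀ = 0 the convention 2/0 = 0 makes every a_k equal to 1, and the weighted sequence stays at
least 1. Applied to `nondegIndex`, this yields an N with β(N) > 0. -/
theorem IsStrictlyDiophantine.pos {g : Module.Basis (Fin l) ℂ 𝔤}
    {S : 𝔤 →ₗ⁅ℂ⁆ Matrix (Fin n) (Fin n) ℂ} {ω : ℕ → ℝ} {μ₀ : ℕ}
    (h : IsStrictlyDiophantine g S ω μ₀) : 0 < μ₀ := by
  rcases Nat.eq_zero_or_pos μ₀ with rfl | h0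
  · have h1 := h.tendsto_zero
    simp only [ratioPow, Nat.cast_zero, div_zero, Real.rpow_zero, mul_one] at h1
    have h2 : ∀ k : ℕ, (1 : ℝ) ≤ ((2 : ℝ) ^ k + n + 1) ^ (n + 1) := fun k =>
      one_le_pow₀ (by have : (0 : ℝ) < 2 ^ k := by positivity
                      have : (0 : ℝ) ≤ n := n.cast_nonneg
                      linarith)
    exact absurd (ge_of_tendsto' h1 h2) (by norm_num)
  · exact h0

theorem IsStrictlyDiophantine.le_supWeightedRatio {g : Module.Basis (Fin l) ℂ 𝔤}
    {S : 𝔤 →ₗ⁅ℂ⁆ Matrix (Fin n) (Fin n) ℂ} {ω : ℕ → ℝ} {μ₀ : ℕ}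
    (h : IsStrictlyDiophantine g S ω μ₀) {k : ℕ} (hk : 1 ≤ k) :
    ((2 : ℝ) ^ k + n + 1) ^ (n + 1) * ratioPow g S ω μ₀ k ≤ supWeightedRatio g S ω μ₀ := by
  obtain ⟨B, hB⟩ := h.tendsto_zero.bddAbove_range
  refine le_ciSup (f := fun k : {k : ℕ // 1 ≤ k} =>
    ((2 : ℝ) ^ (k : ℕ) + n + 1) ^ (n + 1) * ratioPow g S ω μ₀ k) ⟨B, ?_⟩ ⟨k, hk⟩
  rintro _ ⟨j, rfl⟩
  exact hB ⟨j, rfl⟩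

theorem sdiff_diophantineSet_subset (g : Module.Basis (Fin l) ℂ 𝔤)
    (S : 𝔤 →ₗ⁅ℂ⁆ Matrix (Fin n) (Fin n) ℂ) (ω : ℕ → ℝ) (K : Set (CSpace n)) (γ : ℝ)
    (f' : CSpace n → CSpace l) :
    K \ diophantineSet g S ω K γ f' ⊆ ⋃ k : ℕ, ⋃ p ∈ degreeBlock n (k + 1),
      {b ∈ K | weightForm S p.1 p.2 ≠ 0 ∧
        ‖weightForm S p.1 p.2 (∑ j, f' b j • g j)‖ < γ * ω (k + 1)} := by
  rintro b ⟨hbK, hb⟩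
  have : ¬ ∀ i : ℕ, 1 ≤ i → ∀ α ∈ nonzeroWeights S (2 ^ (i - 1) + 1) (2 ^ i),
      γ * ω i ≤ ‖α (∑ j, f' b j • g j)‖ := fun h => hb ⟨hbK, h⟩
  push Not at this
  obtain ⟨i, hi, α, ⟨hα0, Q, m, h1, h2, rfl⟩, hlt⟩ := this
  obtain ⟨k, rfl⟩ : ∃ k, i = k + 1 := ⟨i - 1, by omega⟩
  exact Set.mem_iUnion.2 ⟨k, Set.mem_iUnion₂.2 ⟨(Q, m), mem_degreeBlock.2 ⟨h1, h2⟩, hbK, hα0, hlt⟩⟩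

theorem apply_sum_smul_basis (g : Module.Basis (Fin l) ℂ 𝔤) (α : Module.Dual ℂ 𝔤) (v : CSpace l) :
    α (∑ j, v j • g j) = pairing (WithLp.toLp 2 fun j => α (g j)) v := by
  simp [pairing_apply, map_sum, mul_comm]

end Weights

/-! ### The measure of the diophantine set. -/

theorem mainTheorem3 {n l : ℕ} (hn : 2 ≤ n) (hl : 1 ≤ l)
    {𝔤 : Type*} [LieRing 𝔤] [LieAlgebra ℂ 𝔤] [IsLieAbelian 𝔤]
    (g : Module.Basis (Fin l) ℂ 𝔤)
    (S : 𝔤 →ₗ⁅ℂ⁆ Matrix (Fin n) (Fin n) ℂ)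
    (hSinj : Function.Injective S) (hSdiag : ∀ x, (S x).IsDiag)
    (U : Set (CSpace n)) (hUo : IsOpen U) (hUc : IsConnected U) (h0U : (0 : CSpace n) ∈ U)
    (f : CSpace n → CSpace l) (hf : DifferentiableOn ℂ f U) (hfnd : IsNondegenerateOn U f)
    (K : Set (CSpace n)) (hKc : IsCompact K) (hKne : K.Nonempty) (hKU : K ⊆ U)
    (ω : ℕ → ℝ) (hS : IsStrictlyDiophantine g S ω (nondegIndex f K))
    (ϑ : ℝ) (hϑ0 : 0 < ϑ) (hϑ : ENNReal.ofReal ϑ < ⨅ x ∈ K, Metric.infEDist x Uᶜ)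
    (f' : CSpace n → CSpace l)
    (hf' : ContDiffOn ℝ (nondegIndex f K) f' (Metric.thickening ϑ K))
    (hclose : ckNormOn (Metric.thickening ϑ K) (nondegIndex f K) (fun y => f y - f' y) ≤
      ENNReal.ofReal (closenessBound f K ϑ))
    (ε : ℝ) (hε0 : 0 < ε) (hε : ε < volume.real K)
    (γ : ℝ) (hγ0 : 0 < γ) (hγ : γ ≤ gammaStar g S ω f K ϑ ε) :
    volume.real K - ε ≤ volume.real (diophantineSet g S ω K γ f') := by
  have hϑU := cthickening_subset_of_lt_iInf hϑ
  have hμ := hS.pos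
  have hfs : ∀ z ∈ U, ContDiffAt ℝ (⊤ : ℕ∞) f z := fun z hz => contDiffAt_infty.2 fun m =>
    ((contDiffOn_of_differentiableOn_complex hUo hf m).contDiffAt (hUo.mem_nhds hz)).restrict_scalars ℝ
  -- A set of diameter 0 has measure 0, which contradicts 0 < ε < mes `K`.
  have hd : 0 < Metric.diam K := by
    refine lt_of_le_of_ne Metric.diam_nonneg fun h => ?_
    have h1 := volume_le_diam_pow hKc.isBounded
    rw [finrank_real_CSpace, ← h, zero_pow (by omega), ENNReal.ofReal_zero] at h1
    have h2 : volume.real K = 0 := by rw [Measure.real, nonpos_iff_eq_zero.1 h1, ENNReal.toReal_zero]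
    linarith
  set μ := nondegIndex f K with hμdef
  set a : ℕ → ℝ := ratioPow g S ω μ with ha
  set M := constM f K ϑ with hM
  have hM0 : 0 ≤ M := constM_nonneg f K hϑ0
  have hω : ∀ k, 1 ≤ k → 0 < ω k := hS.diophantine.pos
  have ha0 : ∀ k, 1 ≤ k → 0 ≤ a k := fun k hk => ratioPow_nonneg (hω k hk).le
  have hμ' : (0 : ℝ) < μ := by exact_mod_cast hμ
  have hone : ∀ (k : ℕ) (p : (Fin n → ℕ) × Fin n), p ∈ degreeBlock n (k + 1) →
      volume {b ∈ K | weightForm S p.1 p.2 ≠ 0 ∧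
        ‖weightForm S p.1 p.2 (∑ j, f' b j • g j)‖ < γ * ω (k + 1)} ≤
      ENNReal.ofReal (M * γ ^ (2 / (μ : ℝ)) * a (k + 1)) := by
    intro k p hp
    by_cases h0 : weightForm S p.1 p.2 = 0
    · simp [h0]
    · have hmem : weightForm S p.1 p.2 ∈ nonzeroWeights S (2 ^ (k + 1 - 1) + 1) (2 ^ (k + 1)) := by
        have := mem_degreeBlock.1 hp
        exact ⟨h0, p.1, p.2, this.1, this.2, rfl⟩
      have hw := omegaS_pos g S hmem
      have h1 := volume_norm_pairing_lt_le hn hUo hKc hKne hd hϑ0 hϑU hfs hf' hclose hμ hw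
        ((omegaS_le g S hmem).trans (dualMaxNorm_le_norm g _)) (mul_pos hγ0 (hω (k + 1) (by omega)))
      simp only [h0, ne_eq, not_false_eq_true, true_and, apply_sum_smul_basis]
      refine h1.trans (ENNReal.ofReal_le_ofReal (le_of_eq ?_))
      rw [mul_div_assoc, Real.mul_rpow hγ0.le (div_nonneg (hω (k + 1) (by omega)).le hw.le), ha,
        ratioPow, mul_assoc]
  set D := (2 ^ 2 + (n : ℝ)) ^ n * a 2 - ((n : ℝ) + 1) * a 1 +
    (n : ℝ) / 4 * supWeightedRatio g S ω μ with hD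
  have hfac : (0 : ℝ) < ((n - 1).factorial : ℝ) := by positivity
  have hMsup0 : 0 ≤ supWeightedRatio g S ω μ :=
    le_trans (mul_nonneg (by positivity) (ha0 1 le_rfl)) (hS.le_supWeightedRatio le_rfl)
  have hD0 : 0 ≤ D := le_trans (by positivity)
    (mul_le_threshold hn (ha0 2 (by omega)) hMsup0 (hS.le_supWeightedRatio le_rfl))
  have hγD : M * γ ^ (2 / (μ : ℝ)) * D ≤ ε * ((n - 1).factorial : ℝ) := by
    have h1 : γ ≤ (ε * ((n - 1).factorial : ℝ) / (M * D)) ^ ((μ : ℝ) / 2) := hγ.trans (min_le_left _ _)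
    -- Were the product 0, the quotient would be 0 by convention and so would its power, against γ >
    -- 0.
    have hMD : 0 < M * D := by
      refine lt_of_le_of_ne (mul_nonneg hM0 hD0) fun h => ?_
      rw [← h, div_zero, Real.zero_rpow (by positivity)] at h1
      linarith
    have h2 : γ ^ (2 / (μ : ℝ)) ≤ ε * ((n - 1).factorial : ℝ) / (M * D) := by
      refine (Real.rpow_le_rpow hγ0.le h1 (by positivity)).trans (le_of_eq ?_)
      rw [← Real.rpow_mul (by positivity), div_mul_div_cancel₀ two_ne_zero, div_self hμ'.ne',
        Real.rpow_one]
    rw [le_div_iff₀ hMD] at h2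
    linarith
  have hdiff : volume (K \ diophantineSet g S ω K γ f') ≤ ENNReal.ofReal ε := by
    refine (measure_mono (sdiff_diophantineSet_subset g S ω K γ f')).trans ?_
    refine (measure_iUnion_le _).trans ?_
    have hterm : ∀ k : ℕ, volume (⋃ p ∈ degreeBlock n (k + 1),
        {b ∈ K | weightForm S p.1 p.2 ≠ 0 ∧
          ‖weightForm S p.1 p.2 (∑ j, f' b j • g j)‖ < γ * ω (k + 1)}) ≤
        ENNReal.ofReal (M * γ ^ (2 / (μ : ℝ)) * (((degreeBlock n (k + 1)).card : ℝ) * a (k + 1))) := by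
      intro k
      refine (measure_biUnion_finset_le _ _).trans ((Finset.sum_le_sum (hone k)).trans (le_of_eq ?_))
      rw [Finset.sum_const, ← ENNReal.ofReal_nsmul, nsmul_eq_mul]
      congr 1; ring
    refine (ENNReal.tsum_le_tsum hterm).trans ?_
    rw [ENNReal.tsum_eq_iSup_nat]
    refine iSup_le fun N => ?_
    have hMγ : 0 ≤ M * γ ^ (2 / (μ : ℝ)) := by positivity
    rw [← ENNReal.ofReal_sum_of_nonneg fun k _ =>
      mul_nonneg hMγ (mul_nonneg (Nat.cast_nonneg _) (ha0 (k + 1) (by omega)))]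
    refine ENNReal.ofReal_le_ofReal ?_
    rw [← Finset.mul_sum]
    calc _ ≤ M * γ ^ (2 / (μ : ℝ)) * (D / ((n - 1).factorial : ℝ)) := by
          gcongr
          exact sum_card_degreeBlock_mul_le hn ha0 (fun k hk => hS.le_supWeightedRatio hk) N
      _ ≤ ε := by
          rw [← mul_div_assoc, div_le_iff₀ hfac]
          exact hγD
  have hsub : diophantineSet g S ω K γ f' ⊆ K := fun b hb => hb.1
  -- Subadditivity is enough, so measurability of the diophantine set is not needed.
  have hK : volume K ≤ volume (diophantineSet g S ω K γ f') + ENNReal.ofReal ε := by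
    calc volume K ≤ volume (diophantineSet g S ω K γ f' ∪ K \ diophantineSet g S ω K γ f') :=
          measure_mono (by rw [Set.union_sdiff_self]; exact Set.subset_union_right)
      _ ≤ _ := (measure_union_le _ _).trans (by gcongr)
  have hfin : volume (diophantineSet g S ω K γ f') ≠ ⊤ :=
    ne_top_of_le_ne_top hKc.measure_ne_top (measure_mono hsub)
  have h := ENNReal.toReal_mono (ENNReal.add_ne_top.2 ⟨hfin, ENNReal.ofReal_ne_top⟩) hK
  rw [ENNReal.toReal_add hfin ENNReal.ofReal_ne_top, ENNReal.toReal_ofReal hε0.le] at h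
  simp only [Measure.real]
  linarith
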